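/- **Conventions.** A *tableau* is a semistandard Young tableau with integer entries (rows weakly increasing from left to right, columns strictly increasing from top to bottom); $\emptyset$ is the empty tableau. The product $T\cdot U$ is the usual product of tableaux: the letters of the word of $U$ (rows read left to right, from the bottom row to the top row) are successively row inserted in $T$. A factorization of $W$ is an equation expressing $W$ as a product of tableaux. *Rank conditions* are non-negative integers $r_{ij}$ $(0\le i\le j\le n)$, $n\ge 1$, with $r_{ij}\le\min(r_{i,j-1},r_{i+1,j})$ for $i<j$ and $r_{ij}-r_{i,j-1}-r_{i+1,j}+r_{i+1,j-1}\ge 0$ for $j-i\ge 2$. For $i<j$ let $R_{ij}$ be the rectangle with $r_{i+1,j}-r_{ij}$ rows and $r_{i,j-1}-r_{ij}$ columns (either number may be $0$, and is remembered even if the rectangle is empty). A *tableau diagram* for $r$ consists of a tableau $T_{ij}$ of shape $R_{ij}$ for all $0\le i<j\le n$, such that the entries of $T_{ij}$ are strictly larger than the entries of every $T_{kl}$ with $i\le k<l\le j$ and $(k,l)\ne(i,j)$. It has $n$ rows, the $d$-th row being $T_{0,d},T_{1,d+1},\dots,T_{n-d,n}$. Its bottom $n-1$ rows form the tableau diagram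 $\{T_{i,j+1}\}_{0\le i<j\le n-1}$ for the rank conditions $(r_{i,j+1})_{0\le i\le j\le n-1}$. *Factor sequences* for a tableau diagram with $n$ rows are sequences of $n$ tableaux defined by induction. If $n=1$, the only factor sequence is $(T_{01})$. If $n\ge2$, the factor sequences are the sequences $$(T_{01}\cdot P_1,\; Q_1\cdot T_{12}\cdot P_2,\;\dots,\; Q_{n-2}\cdot T_{n-2,n-1}\cdot P_{n-1},\; Q_{n-1}\cdot T_{n-1,n}),$$ where $(U_1,\dots,U_{n-1})$ is a factor sequence for the bottom $n-1$ rows and $U_i=P_i\cdot Q_i$ are arbitrary factorizations. (By convention the empty sequence is the only factor sequence for the diagram with no rows.) Let $W$ be a tableau whose shape contains the rectangle $(b)^a$ with $a$ rows and $b$ columns. Let $T$ be the part of $W$ in this rectangle, $P_0$ the rest of the top $a$ rows of $W$, $Q_0$ the part of the first $b$ columns of $W$ below row $a$, and $Z$ the part of $W$ in the rows after row $a$ and the columns after column $b$. A *simple factorization* of $W$ with respect to $(b)^a$ is a factorization $W=Q\cdot T\cdot P$ such that $Q=Q_0\cdot\tilde Q$ and $P=\tilde P\cdot P_0$ for some factorization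 $Z=\tilde Q\cdot\tilde P$. **Theorem.** Let $n\ge 1$, let $\{T_{ij}\}$ be a tableau diagram with $n$ rows, and let $(W_1,\dots,W_n)$ be a sequence of tableaux such that each $W_i$ contains $T_{i-1,i}$ in its upper-left corner. For each $i$ let $W_i=Q_{i-1}\cdot T_{i-1,i}\cdot P_i$ be any simple factorization of $W_i$ with respect to the rectangle $R_{i-1,i}$. Then $(W_1,\dots,W_n)$ is a factor sequence for $\{T_{ij}\}$ if and only if $Q_0$ and $P_n$ are empty tableaux and $(P_1\cdot Q_1,\dots,P_{n-1}\cdot Q_{n-1})$ is a factor sequence for the bottom $n-1$ rows of $\{T_{ij}\}$. -/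

import Mathlib

/-! ### Semistandard tableaux with integer entries -/

/-- `ColLT r s`: the row `s` can stand below the row `r`, i.e. `s` is at most as long as `r`
and each entry of `s` is strictly larger than the entry of `r` in the same column. -/
def ColLT : List ℤ → List ℤ → Prop
  | _, [] => True
  | [], _ :: _ => False
  | x :: r, y :: s => x < y ∧ ColLT r s

/-- A list of rows (top row first) is a semistandard tableau: its rows are non-empty and weakly
increasing, their lengths weakly decrease, and the columns are strictly increasing. -/
structure IsTableau (rows : List (List ℤ)) : Prop where
  ne_nil : ∀ r ∈ rows, r ≠ []
  row_weak : ∀ r ∈ rows, r.Pairwise (· ≤ ·)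
  col_strict : rows.Pairwise ColLT

/-- Semistandard Young tableaux with entries in `ℤ`, given by their rows from top to bottom. -/
@[ext]
structure Tableau where
  rows : List (List ℤ)
  isTableau : IsTableau rows

/-- Row bumping in one row: if some entry is strictly larger than `x`, then `x` replaces the
leftmost such entry, which is returned; otherwise `x` is put at the end of the row. -/
def rowInsert (x : ℤ) : List ℤ → List ℤ × Option ℤ
  | [] => ([x], none)
  | y :: r => if x < y then (x :: r, some y) else (y :: (rowInsert x r).1, (rowInsert x r).2)

/-- Row insertion of `x` in a tableau: insert `x` in the first row, insert the entry
bumped out of it (if any) in the second row, and so on. -/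
def insertRows (x : ℤ) : List (List ℤ) → List (List ℤ)
  | [] => [[x]]
  | r :: rs => (rowInsert x r).1 ::
      match (rowInsert x r).2 with
      | none => rs
      | some y => insertRows y rs

theorem ColLT.trans : ∀ {r s t : List ℤ}, ColLT r s → ColLT s t → ColLT r t
  | _, _, [], _, _ => by simp [ColLT]
  | _, [], _ :: _, _, h => by simp [ColLT] at h
  | [], _ :: _, _ :: _, h, _ => by simp [ColLT] at h
  | _ :: _, _ :: _, _ :: _, h, h' => ⟨h.1.trans h'.1, ColLT.trans h.2 h'.2⟩

theorem ColLT.take (b : ℕ) : ∀ {r s : List ℤ}, ColLT r s → ColLT (r.take b) (s.take b) := by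
  induction b with
  | zero => intro r s _; simp [ColLT]
  | succ b ih =>
    intro r s h
    cases s with
    | nil => simp [ColLT]
    | cons y s =>
      cases r with
      | nil => simp [ColLT] at h
      | cons x r => exact ⟨h.1, ih h.2⟩

theorem ColLT.drop (b : ℕ) : ∀ {r s : List ℤ}, ColLT r s → ColLT (r.drop b) (s.drop b) := by
  induction b with
  | zero => intro r s h; simpa using h
  | succ b ih =>
    intro r s h
    cases s with
    | nil => simp [ColLT]
    | cons y s =>
      cases r with
      | nil => simp [ColLT] at h
      | cons x r => exact ih h.2

theorem rowInsert_ne_nil (x : ℤ) (r : List ℤ) : (rowInsert x r).1 ≠ [] := by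
  cases r with
  | nil => simp [rowInsert]
  | cons y r => simp only [rowInsert]; split <;> simp

theorem mem_rowInsert {x z : ℤ} : ∀ {r : List ℤ}, z ∈ (rowInsert x r).1 → z = x ∨ z ∈ r
  | [], h => by simpa [rowInsert] using h
  | y :: r, h => by
    simp only [rowInsert] at h
    split at h
    · simp only [List.mem_cons] at h ⊢; tauto
    · simp only [List.mem_cons] at h ⊢
      rcases h with h | h
      · tauto
      · have := mem_rowInsert h; tauto

theorem rowInsert_sorted (x : ℤ) :
    ∀ {r : List ℤ}, r.Pairwise (· ≤ ·) → (rowInsert x r).1.Pairwise (· ≤ ·)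
  | [], _ => by simp [rowInsert]
  | y :: r, h => by
    rw [List.pairwise_cons] at h
    simp only [rowInsert]
    split
    · rename_i hxy
      rw [List.pairwise_cons]
      exact ⟨fun z hz => hxy.le.trans (h.1 z hz), h.2⟩
    · rename_i hxy
      rw [List.pairwise_cons]
      refine ⟨fun z hz => ?_, rowInsert_sorted x h.2⟩
      rcases mem_rowInsert hz with rfl | hz
      · exact not_lt.mp hxy
      · exact h.1 z hz

theorem ColLT.rowInsert_left (x : ℤ) : ∀ {r s : List ℤ}, ColLT r s → ColLT (rowInsert x r).1 s
  | _, [], _ => by simp [ColLT]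
  | [], _ :: _, h => by simp [ColLT] at h
  | y :: r, z :: s, h => by
    simp only [rowInsert]
    split
    · rename_i hxy; exact ⟨hxy.trans h.1, h.2⟩
    · exact ⟨h.1, h.2.rowInsert_left x⟩

theorem lt_of_rowInsert {x y : ℤ} : ∀ {r : List ℤ}, (rowInsert x r).2 = some y → x < y
  | [], h => by simp [rowInsert] at h
  | z :: r, h => by
    simp only [rowInsert] at h
    split at h
    · rename_i hxz; simp only [Option.some.injEq] at h; omega
    · exact lt_of_rowInsert h

theorem ColLT.rowInsert_both {x y : ℤ} : ∀ {r s : List ℤ}, ColLT r s →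
    (rowInsert x r).2 = some y → ColLT (rowInsert x r).1 (rowInsert y s).1
  | [], _, _, h => by simp [rowInsert] at h
  | z :: r, [], _, h => by
    have hxy := lt_of_rowInsert h
    simp only [rowInsert] at h ⊢
    split
    · simp [ColLT, hxy]
    · rename_i hxz; simp only [ColLT, and_true]; omega
  | z :: r, w :: s, hc, h => by
    have hxy := lt_of_rowInsert h
    obtain ⟨hzw, hc⟩ := hc
    simp only [rowInsert] at h
    split at h
    · rename_i hxz
      simp only [Option.some.injEq] at h
      subst h
      simp only [rowInsert, hxz, hzw, if_true]
      exact ⟨hxy, hc⟩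
    · rename_i hxz
      simp only [rowInsert, hxz, if_false]
      split
      · exact ⟨by omega, hc.rowInsert_left x⟩
      · exact ⟨hzw, hc.rowInsert_both h⟩

theorem isTableau_cons {r : List ℤ} {rs : List (List ℤ)} :
    IsTableau (r :: rs) ↔
      r ≠ [] ∧ r.Pairwise (· ≤ ·) ∧ (∀ s ∈ rs, ColLT r s) ∧ IsTableau rs := by
  constructor
  · rintro ⟨h1, h2, h3⟩
    simp only [List.forall_mem_cons, List.pairwise_cons] at h1 h2 h3
    exact ⟨h1.1, h2.1, h3.1, h1.2, h2.2, h3.2⟩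
  · rintro ⟨h1, h2, h3, h4, h5, h6⟩
    exact ⟨List.forall_mem_cons.2 ⟨h1, h4⟩, List.forall_mem_cons.2 ⟨h2, h5⟩,
      List.pairwise_cons.2 ⟨h3, h6⟩⟩

theorem isTableau_nil : IsTableau [] := ⟨by simp, by simp, by simp⟩

theorem IsTableau.insertRows (x : ℤ) {rows : List (List ℤ)} (h : IsTableau rows) :
    IsTableau (insertRows x rows) := by
  induction rows generalizing x with
  | nil => exact isTableau_cons.2 ⟨by simp, by simp, by simp, isTableau_nil⟩
  | cons r rs ih =>
    obtain ⟨_, h2, h3, h4⟩ := isTableau_cons.1 h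
    simp only [_root_.insertRows]
    split
    · exact isTableau_cons.2 ⟨rowInsert_ne_nil x r, rowInsert_sorted x h2,
        fun s hs => (h3 s hs).rowInsert_left x, h4⟩
    · rename_i y hy
      refine isTableau_cons.2 ⟨rowInsert_ne_nil x r, rowInsert_sorted x h2, ?_, ih y h4⟩
      have ht := ih y h4
      cases rs with
      | nil =>
        have := ColLT.rowInsert_both (s := []) (by simp [ColLT]) hy
        simpa [_root_.insertRows, rowInsert] using this
      | cons s rs =>
        have key := (h3 s (by simp)).rowInsert_both hy
        simp only [_root_.insertRows] at ht ⊢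
        intro t hmem
        rcases List.mem_cons.1 hmem with rfl | hmem
        · exact key
        · exact key.trans ((isTableau_cons.1 ht).2.2.1 t hmem)

theorem IsTableau.foldl_insertRows (w : List ℤ) {rows : List (List ℤ)} (h : IsTableau rows) :
    IsTableau (w.foldl (fun t x => _root_.insertRows x t) rows) := by
  induction w generalizing rows with
  | nil => exact h
  | cons x w ih => exact ih (h.insertRows x)

theorem IsTableau.of_sublist {rows rows' : List (List ℤ)} (h : IsTableau rows)
    (hs : rows'.Sublist rows) : IsTableau rows' :=
  ⟨fun r hr => h.ne_nil r (hs.subset hr), fun r hr => h.row_weak r (hs.subset hr),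
    h.col_strict.sublist hs⟩

theorem IsTableau.map_filter {rows : List (List ℤ)} (h : IsTableau rows) (f : List ℤ → List ℤ)
    (hf : ∀ r, (f r).Sublist r) (hc : ∀ r s, ColLT r s → ColLT (f r) (f s)) :
    IsTableau ((rows.map f).filter (· ≠ [])) := by
  refine ⟨fun r hr => by simpa using (List.mem_filter.1 hr).2, fun r hr => ?_, ?_⟩
  · obtain ⟨s, hs, rfl⟩ := List.mem_map.1 (List.mem_filter.1 hr).1
    exact (h.row_weak s hs).sublist (hf s)
  · exact (List.Pairwise.map f hc h.col_strict).sublist List.filter_sublist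

namespace Tableau

instance : EmptyCollection Tableau := ⟨⟨[], isTableau_nil⟩⟩

/-- The entry in row `i` and column `j` (counted from `0`), `none` if there is no such box. -/
def entry (T : Tableau) (i j : ℕ) : Option ℤ := T.rows[i]?.bind fun r => r[j]?

/-- The (row) word of a tableau: its rows read from left to right, from the bottom row to the
top row. -/
def word (T : Tableau) : List ℤ := T.rows.reverse.flatten

/-- The product `T · U` of tableaux: the letters of the word of `U` are successively
row inserted in `T`. -/
instance : Mul Tableau :=
  ⟨fun T U => ⟨U.word.foldl (fun t x => insertRows x t) T.rows, T.isTableau.foldl_insertRows _⟩⟩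

/-- The top `a` rows. -/
def top (a : ℕ) (T : Tableau) : Tableau :=
  ⟨T.rows.take a, T.isTableau.of_sublist (List.take_sublist a _)⟩

/-- The part below the top `a` rows. -/
def below (a : ℕ) (T : Tableau) : Tableau :=
  ⟨T.rows.drop a, T.isTableau.of_sublist (List.drop_sublist a _)⟩

/-- The first `b` columns. -/
def left (b : ℕ) (T : Tableau) : Tableau :=
  ⟨(T.rows.map (List.take b)).filter (· ≠ []),
    T.isTableau.map_filter _ (List.take_sublist b) fun _ _ h => h.take b⟩

/-- The part to the right of the first `b` columns. -/
def right (b : ℕ) (T : Tableau) : Tableau :=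
  ⟨(T.rows.map (List.drop b)).filter (· ≠ []),
    T.isTableau.map_filter _ (List.drop_sublist b) fun _ _ h => h.drop b⟩

/-- The shape of `T` is the rectangle `(b)^a` with `a` rows and `b` columns
(so `T` is empty if `a = 0` or `b = 0`). -/
def IsRect (a b : ℕ) (T : Tableau) : Prop :=
  ∀ i j, (T.entry i j).isSome ↔ i < a ∧ j < b

/-- `W` contains the tableau `T` in its upper-left corner. -/
def ContainsUpperLeft (W T : Tableau) : Prop :=
  ∀ i j x, T.entry i j = some x → W.entry i j = some x

/-- `W = Q · T · P` is a simple factorization of `W` with respect to the rectangle `(b)^a`.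
Here `T` is the part of `W` in this rectangle, `Q₀ = (W.below a).left b` is the part of `W`
below `T`, `P₀ = (W.top a).right b` is the part to the right of `T`, and
`Z = (W.below a).right b` is the remaining part. -/
def IsSimpleFactorization (a b : ℕ) (W Q T P : Tableau) : Prop :=
  T = (W.top a).left b ∧ W = Q * T * P ∧
    ∃ Q' P' : Tableau, (W.below a).right b = Q' * P' ∧
      Q = (W.below a).left b * Q' ∧ P = P' * (W.top a).right b

end Tableau

/-! ### Rank conditions and tableau diagrams -/

/-- Rank conditions `r i j`, `0 ≤ i ≤ j ≤ n`, that can occur; the values of `r` at other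
indices are irrelevant. -/
structure RankConditions (n : ℕ) where
  r : ℕ → ℕ → ℕ
  le_left : ∀ i j, i < j → j ≤ n → r i j ≤ r i (j - 1)
  le_right : ∀ i j, i < j → j ≤ n → r i j ≤ r (i + 1) j
  occur : ∀ i j, i + 2 ≤ j → j ≤ n → r i (j - 1) + r (i + 1) j ≤ r i j + r (i + 1) (j - 1)

namespace RankConditions

/-- The number of rows of the rectangle `R i j`, for `i < j`. -/
def numRows {n : ℕ} (r : RankConditions n) (i j : ℕ) : ℕ := r.r (i + 1) j - r.r i j

/-- The number of columns of the rectangle `R i j`, for `i < j`. -/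
def numCols {n : ℕ} (r : RankConditions n) (i j : ℕ) : ℕ := r.r i (j - 1) - r.r i j

/-- The rank conditions obtained by removing the top row of the rank diagram. -/
def bottom {n : ℕ} (r : RankConditions (n + 1)) : RankConditions n where
  r i j := r.r i (j + 1)
  le_left i j h h' := by
    have := r.le_left i (j + 1) (by omega) (by omega)
    rwa [show j + 1 - 1 = j - 1 + 1 by omega] at this
  le_right i j h h' := r.le_right i (j + 1) (by omega) (by omega)
  occur i j h h' := by
    have := r.occur i (j + 1) (by omega) (by omega)
    rwa [show j + 1 - 1 = j - 1 + 1 by omega] at this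

end RankConditions

/-- A tableau diagram for the rank conditions `r`: a tableau `T i j` of shape `R i j` for all
`0 ≤ i < j ≤ n`, whose entries are strictly larger than the entries of each `T k l` with
`i ≤ k < l ≤ j` and `(k, l) ≠ (i, j)`. The values of `T` at other indices are irrelevant. -/
structure TableauDiagram {n : ℕ} (r : RankConditions n) where
  T : ℕ → ℕ → Tableau
  isRect : ∀ i j, i < j → j ≤ n → (T i j).IsRect (r.numRows i j) (r.numCols i j)
  lt : ∀ i j k l, i ≤ k → k < l → l ≤ j → j ≤ n → (k, l) ≠ (i, j) →
    ∀ x ∈ (T k l).word, ∀ y ∈ (T i j).word, x < y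

/-- The tableau diagram formed by all rows but the top one. -/
def TableauDiagram.bottom {n : ℕ} {r : RankConditions (n + 1)} (D : TableauDiagram r) :
    TableauDiagram r.bottom where
  T i j := D.T i (j + 1)
  isRect i j h h' := by
    have := D.isRect i (j + 1) (by omega) (by omega)
    simp only [RankConditions.numRows, RankConditions.numCols, RankConditions.bottom] at this ⊢
    rwa [show j + 1 - 1 = j - 1 + 1 by omega] at this
  lt i j k l h1 h2 h3 h4 h5 := D.lt i (j + 1) k (l + 1) h1 (by omega) (by omega) (by omega)
    (by simpa using h5)

/-- Factor sequences for a tableau diagram with `n` rows. The sequence `(W_1, …, W_n)` is indexed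
by `Fin n`, i.e. `W i` stands for `W_{i+1}`. The case of no rows is the convention
that the empty sequence is a factor sequence for the empty diagram. In the last case, `P i` and
`Q i` stand for `P_{i+1}` and `Q_{i+1}`. -/
def IsFactorSequence : {n : ℕ} → {r : RankConditions n} → TableauDiagram r →
    (Fin n → Tableau) → Prop
  | 0, _, _, _ => True
  | 1, _, D, W => W 0 = D.T 0 1
  | n + 2, _, D, W =>
    ∃ U P Q : Fin (n + 1) → Tableau,
      IsFactorSequence D.bottom U ∧
      (∀ i, U i = P i * Q i) ∧
      W 0 = D.T 0 1 * P 0 ∧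
      (∀ i : Fin n, W i.succ.castSucc =
        Q i.castSucc * D.T (i + 1) (i + 2) * P i.succ) ∧
      W (Fin.last (n + 1)) = Q (Fin.last n) * D.T (n + 1) (n + 2)

/-! A simple factorization is in particular a factorization, so one direction is immediate.
Conversely, a factor sequence comes with some factorizations W_i = Q_{i-1} · T_{i-1,i} · P_i such
that the products P_i · Q_i form a factor sequence for the bottom rows. These factorizations are
replaced by the given simple ones, one index at a time, without losing this property
(`IsFactorPair.update_simple`).

At one index, let Q · T · P be the current factorization and (b)^a the rectangle. Three transfers
between Q and P suffice. The columns of Q after column b go to P: they pass across T because the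
entries of T are smaller (`Tableau.mul_rect`). Now Q has at most b columns, T lies in the corner of
W, and the part of W below row a is Q times the part of P below row a (`Tableau.mul_rect_mul`); that
part of P goes to Q, and the factors become the part of W below row a and P₀. Finally the prescribed
right factor of Z goes back to P.

A transfer changes two neighbours of the bottom sequence: one loses a factor and the other gains it.
By induction on the number of rows, simple factorizations are already known to work for the bottom
sequence. Putting all of Z on one side there shows the moved tableau as an outer factor of some P or
Q, and regrouping a product P · Q one level further down leaves that level unchanged
(`IsFactorSequence.move_right`, `IsFactorSequence.move_left`).

For this the lost factor must be visible in a cut of the product along a column or a row of the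
lower rectangle. Multiplication from the left affects columns after b only by multiplying them by
what leaves the first b columns (`Tableau.left_mul`, by column insertion); `Tableau.top_mul` is the
analogue for rows. Factors of a cut-off part fit where that part was (`Tableau.beside_left_factor`,
`Tableau.below_right_factor`), and the rank inequalities bound the lower rectangle by its upper
neighbours. -/

/-! ### Row insertion of words and the plactic relations -/

/-- Successive row insertion of the letters of a word in a list of rows. -/
def insertWord (T : List (List ℤ)) (w : List ℤ) : List (List ℤ) :=
  w.foldl (fun t x => insertRows x t) T

/-- Successive insertion of the letters of a word in a single row: the resulting row, and the word
formed by the entries that are bumped out. -/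
def rowInsertWord : List ℤ → List ℤ → List ℤ × List ℤ
  | r, [] => (r, [])
  | r, x :: w => ((rowInsertWord (rowInsert x r).1 w).1,
      (rowInsert x r).2.toList ++ (rowInsertWord (rowInsert x r).1 w).2)

@[simp] theorem insertWord_nil (T : List (List ℤ)) : insertWord T [] = T := rfl

@[simp] theorem insertWord_cons (T : List (List ℤ)) (x : ℤ) (w : List ℤ) :
    insertWord T (x :: w) = insertWord (insertRows x T) w := rfl

theorem insertWord_append (T : List (List ℤ)) (u w : List ℤ) :
    insertWord T (u ++ w) = insertWord (insertWord T u) w := List.foldl_append ..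

theorem IsTableau.insertWord {T : List (List ℤ)} (h : IsTableau T) (w : List ℤ) :
    IsTableau (insertWord T w) := h.foldl_insertRows w

/-- The rows below see only the bumped letters and their order. This permits proofs about products
by induction on rows. -/
theorem insertWord_rows_cons (r : List ℤ) (rs : List (List ℤ)) (w : List ℤ) :
    insertWord (r :: rs) w = (rowInsertWord r w).1 :: insertWord rs (rowInsertWord r w).2 := by
  induction w generalizing r rs with
  | nil => rfl
  | cons x w ih =>
    simp only [insertWord_cons, insertRows, rowInsertWord]
    rcases h : (rowInsert x r).2 with _ | y <;> simp [ih]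

theorem insertWord_singleton_nil {w : List ℤ} (hw : w ≠ []) :
    insertWord [[]] w = insertWord [] w := by
  cases w with
  | nil => exact absurd rfl hw
  | cons x w => simp [insertRows, rowInsert]

theorem insertWord_nil_rows {w : List ℤ} (hw : w ≠ []) :
    insertWord [] w = (rowInsertWord [] w).1 :: insertWord [] (rowInsertWord [] w).2 := by
  rw [← insertWord_singleton_nil hw, insertWord_rows_cons]

theorem rowInsertWord_cons_of_le {h : ℤ} {w : List ℤ} (hw : ∀ x ∈ w, h ≤ x) (r : List ℤ) :
    rowInsertWord (h :: r) w = (h :: (rowInsertWord r w).1, (rowInsertWord r w).2) := by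
  induction w generalizing r with
  | nil => rfl
  | cons x w ih =>
    have hx : ¬ x < h := not_lt.2 (hw x (by simp))
    simp [rowInsertWord, rowInsert, hx, ih fun y hy => hw y (by simp [hy])]

theorem rowInsertWord_append_of_le {l w : List ℤ} (hw : ∀ h ∈ l, ∀ x ∈ w, h ≤ x) (r : List ℤ) :
    rowInsertWord (l ++ r) w = (l ++ (rowInsertWord r w).1, (rowInsertWord r w).2) := by
  induction l with
  | nil => rfl
  | cons h l ih =>
    rw [List.cons_append, rowInsertWord_cons_of_le (hw h (by simp)),
      ih fun k hk => hw k (by simp [hk])]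
    rfl

theorem self_mem_rowInsert (x : ℤ) (r : List ℤ) : x ∈ (rowInsert x r).1 := by
  induction r with
  | nil => simp [rowInsert]
  | cons y r ih => simp only [rowInsert]; split <;> simp [ih]

theorem rowInsert_bumped_mem {x y : ℤ} {r : List ℤ} (h : (rowInsert x r).2 = some y) : y ∈ r := by
  induction r with
  | nil => simp [rowInsert] at h
  | cons z r ih =>
    simp only [rowInsert] at h
    split at h
    · simp_all
    · exact List.mem_cons_of_mem _ (ih h)

theorem rowInsert_bumped_le {x z : ℤ} {r : List ℤ} (hr : r.Pairwise (· ≤ ·)) (hz : z ∈ r)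
    (hxz : x < z) : ∃ y, (rowInsert x r).2 = some y ∧ y ≤ z := by
  induction r with
  | nil => simp at hz
  | cons h r ih =>
    rw [List.pairwise_cons] at hr
    by_cases hx : x < h
    · refine ⟨h, by simp [rowInsert, hx], ?_⟩
      rcases List.mem_cons.1 hz with rfl | hz
      · exact le_rfl
      · exact hr.1 z hz
    · rcases List.mem_cons.1 hz with rfl | hz
      · exact absurd hxz hx
      · simpa [rowInsert, hx] using ih hr.2 hz

/-- The letter bumped by `z` cannot be the new `y`, so it was already in `r` and exceeds `y`; hence
`y` bumped something no larger. -/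
theorem rowInsert_rowInsert_bumped {y z : ℤ} {r : List ℤ} (hr : r.Pairwise (· ≤ ·)) (hyz : y ≤ z)
    {z' : ℤ} (h : (rowInsert z (rowInsert y r).1).2 = some z') :
    ∃ y', (rowInsert y r).2 = some y' ∧ y' ≤ z' := by
  have hz := lt_of_rowInsert h
  rcases mem_rowInsert (rowInsert_bumped_mem h) with rfl | hm
  · exact absurd hz (by omega)
  · exact rowInsert_bumped_le hr hm (by omega)

/-- The elementary Knuth relations between words of three letters, together with equality. -/
inductive Knuth : List ℤ → List ℤ → Prop
  | refl (w : List ℤ) : Knuth w w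
  | yzx {x y z : ℤ} : x < y → y ≤ z → Knuth [y, z, x] [y, x, z]
  | xzy {x y z : ℤ} : x ≤ y → y < z → Knuth [x, z, y] [z, x, y]

/-- If the smallest letter is at least the head of the row, all three letters pass the head and
induction applies. Otherwise the outcomes are compared directly. Fewer than three letters may be
bumped, and then the bumped words coincide; this is why `Knuth` includes equality. -/
theorem Knuth.rowInsertWord {w w' : List ℤ} (hk : Knuth w w') {r : List ℤ}
    (hr : r.Pairwise (· ≤ ·)) : (rowInsertWord r w).1 = (rowInsertWord r w').1 ∧
      Knuth (rowInsertWord r w).2 (rowInsertWord r w').2 := by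
  induction r with
  | nil =>
    cases hk with
    | refl => exact ⟨rfl, .refl _⟩
    | @yzx x y z h1 h2 =>
      simp [_root_.rowInsertWord, rowInsert, h1, not_lt.2 h2, (h1.trans_le h2).not_gt, Knuth.refl]
    | @xzy x y z h1 h2 =>
      simp [_root_.rowInsertWord, rowInsert, h2, not_lt.2 h1, (h1.trans_lt h2), (h1.trans_lt h2).not_gt,
        Knuth.refl]
  | cons h r ih =>
    rw [List.pairwise_cons] at hr
    obtain ⟨hh, hr⟩ := hr
    cases hk with
    | refl => exact ⟨rfl, .refl _⟩
    | @yzx x y z h1 h2 =>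
      by_cases hx : x < h
      · by_cases hy : y < h
        · have hzy : ¬ z < y := not_lt.2 h2
          have hzx : ¬ z < x := by omega
          simp only [_root_.rowInsertWord, rowInsert, hy, if_true, h1, hzy, if_false, hzx, true_and]
          rcases hz : (rowInsert z r).2 with _ | z'
          · exact .refl _
          · exact .yzx hy (hh _ (rowInsert_bumped_mem hz))
        · have hz : ¬ z < h := by omega
          have hzx : ¬ z < x := by omega
          simp only [_root_.rowInsertWord, rowInsert, hy, if_false, hx, hz, if_true, hzx, true_and]
          rcases hz : (rowInsert z (rowInsert y r).1).2 with _ | z'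
          · exact .refl _
          · obtain ⟨y', hy', hle⟩ := rowInsert_rowInsert_bumped hr h2 hz
            rw [hy']
            exact .yzx (by have := lt_of_rowInsert hy'; omega) hle
      · have hpass : ∀ v : List ℤ, (∀ t ∈ v, x ≤ t) → _root_.rowInsertWord (h :: r) v = _ :=
          fun v hv => rowInsertWord_cons_of_le (fun t ht => (not_lt.1 hx).trans (hv t ht)) r
        rw [hpass [y, z, x] (by simp; omega), hpass [y, x, z] (by simp; omega)]
        exact ⟨by rw [(ih hr).1], (ih hr).2⟩
    | @xzy x y z h1 h2 =>
      by_cases hx : x < h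
      · have hyx : ¬ y < x := not_lt.2 h1
        have hzx : ¬ z < x := by omega
        have hxz : x < z := by omega
        by_cases hz : z < h
        · cases r with
          | nil =>
            simp [_root_.rowInsertWord, rowInsert, hx, hz, hyx, hzx, hxz, h2, Knuth.refl]
          | cons k r =>
            have hk : h ≤ k := hh k (by simp)
            have hzk : z < k := by omega
            have hyk : y < k := by omega
            simp only [_root_.rowInsertWord, rowInsert, hx, hz, hyx, hzx, hxz, h2, hzk, hyk, if_true,
              if_false, true_and]
            -- The bumped words are `h k z` and `h z k`, so a relation of type `xzy` in this row
            -- becomes one of type `yzx` in the next.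
            exact .yzx hz hk
        · simp only [_root_.rowInsertWord, rowInsert, hx, hz, hyx, hzx, if_true, if_false, true_and]
          obtain ⟨y', hy', hle⟩ := rowInsert_bumped_le (rowInsert_sorted z hr)
            (self_mem_rowInsert z r) h2
          rcases hz' : (rowInsert z r).2 with _ | z'
          · exact .refl _
          · rw [hy']
            refine .xzy ?_ (hle.trans_lt (lt_of_rowInsert hz'))
            rcases mem_rowInsert (rowInsert_bumped_mem hy') with rfl | hm
            · omega
            · exact hh _ hm
      · have hpass : ∀ v : List ℤ, (∀ t ∈ v, x ≤ t) → _root_.rowInsertWord (h :: r) v = _ :=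
          fun v hv => rowInsertWord_cons_of_le (fun t ht => (not_lt.1 hx).trans (hv t ht)) r
        rw [hpass [x, z, y] (by simp; omega), hpass [z, x, y] (by simp; omega)]
        exact ⟨by rw [(ih hr).1], (ih hr).2⟩

/-- Two words are plactically equivalent if inserting either of them in any tableau has the same
result. -/
def PlacticEquiv (w w' : List ℤ) : Prop :=
  ∀ T, IsTableau T → insertWord T w = insertWord T w'

theorem Knuth.placticEquiv_nil {w w' : List ℤ} (h : Knuth w w') :
    insertWord [] w = insertWord [] w' := by
  cases h with
  | refl => rfl
  | yzx h1 h2 => simp [insertRows, rowInsert, h1, not_lt.2 h2, (h1.trans_le h2).not_gt]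
  | xzy h1 h2 =>
    simp [insertRows, rowInsert, h2, not_lt.2 h1, (h1.trans_lt h2), (h1.trans_lt h2).not_gt]

theorem Knuth.placticEquiv {w w' : List ℤ} (h : Knuth w w') : PlacticEquiv w w' := by
  intro T hT
  induction T generalizing w w' with
  | nil => exact h.placticEquiv_nil
  | cons r rs ih =>
    obtain ⟨_, h2, _, h4⟩ := isTableau_cons.1 hT
    obtain ⟨e, hk⟩ := h.rowInsertWord h2
    rw [insertWord_rows_cons, insertWord_rows_cons, e, ih hk h4]

namespace PlacticEquiv

theorem refl (w : List ℤ) : PlacticEquiv w w := fun _ _ => rfl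

theorem symm {u v : List ℤ} (h : PlacticEquiv u v) : PlacticEquiv v u := fun T hT => (h T hT).symm

theorem trans {u v w : List ℤ} (h : PlacticEquiv u v) (h' : PlacticEquiv v w) : PlacticEquiv u w :=
  fun T hT => (h T hT).trans (h' T hT)

theorem append {u u' v v' : List ℤ} (h : PlacticEquiv u u') (h' : PlacticEquiv v v') :
    PlacticEquiv (u ++ v) (u' ++ v') := fun T hT => by
  rw [insertWord_append, insertWord_append, h T hT, h' _ (hT.insertWord u')]

theorem append_left (u : List ℤ) {v v' : List ℤ} (h : PlacticEquiv v v') :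
    PlacticEquiv (u ++ v) (u ++ v') := (refl u).append h

theorem append_right {u u' : List ℤ} (h : PlacticEquiv u u') (v : List ℤ) :
    PlacticEquiv (u ++ v) (u' ++ v) := h.append (refl v)

theorem cons (x : ℤ) {v v' : List ℤ} (h : PlacticEquiv v v') :
    PlacticEquiv (x :: v) (x :: v') := append_left [x] h

end PlacticEquiv

/-- A letter smaller than all letters of a weakly increasing word moves to the left through all
letters but the first one. -/
theorem placticEquiv_move_left {x h : ℤ} {r : List ℤ} (hx : x < h)
    (hr : (h :: r).Pairwise (· ≤ ·)) : PlacticEquiv (h :: (r ++ [x])) (h :: x :: r) := by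
  induction r generalizing h with
  | nil => exact .refl _
  | cons k r ih =>
    rw [List.pairwise_cons] at hr
    have hk : h ≤ k := hr.1 k (by simp)
    have h1 := (ih (hx.trans_le hk) hr.2).cons h
    exact h1.trans ((Knuth.yzx hx hk).placticEquiv.append_right r)

theorem head_rowInsert_le {x y : ℤ} {r : List ℤ} (h : (rowInsert x r).2 = some y) :
    ∃ e s, (rowInsert x r).1 = e :: s ∧ e ≤ x ∧ (e = x ∨ e ∈ r) := by
  cases r with
  | nil => simp [rowInsert] at h
  | cons k r =>
    by_cases hx : x < k
    · exact ⟨x, r, by simp [rowInsert, hx], le_rfl, .inl rfl⟩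
    · exact ⟨k, _, by simp [rowInsert, hx]; rfl, not_lt.1 hx, by simp⟩

theorem rowInsert_eq_append {x : ℤ} {r : List ℤ} (h : (rowInsert x r).2 = none) :
    (rowInsert x r).1 = r ++ [x] := by
  induction r with
  | nil => rfl
  | cons k r ih =>
    by_cases hx : x < k
    · simp [rowInsert, hx] at h
    · simp only [rowInsert, hx, if_false] at h ⊢
      rw [ih h]; rfl

/-- The letter `x` moves left through the entries after `y` by relations `yzx`; then `y` moves left
to the front by relations `xzy`. -/
theorem placticEquiv_rowInsert {x y : ℤ} {r : List ℤ} (hr : r.Pairwise (· ≤ ·))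
    (h : (rowInsert x r).2 = some y) : PlacticEquiv (r ++ [x]) (y :: (rowInsert x r).1) := by
  induction r with
  | nil => simp [rowInsert] at h
  | cons k r ih =>
    by_cases hx : x < k
    · simp only [rowInsert, hx, if_true, Option.some.injEq] at h ⊢
      subst h
      exact placticEquiv_move_left hx hr
    · rw [List.pairwise_cons] at hr
      simp only [rowInsert, hx, if_false] at h ⊢
      have h1 := (ih hr.2 h).cons k
      obtain ⟨e, s, hes, hex, hmem⟩ := head_rowInsert_le h
      have hke : k ≤ e := by
        rcases hmem with rfl | hm
        · omega
        · exact hr.1 e hm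
      refine h1.trans ?_
      rw [hes]
      exact (Knuth.xzy hke (hex.trans_lt (lt_of_rowInsert h))).placticEquiv.append_right s

/-- The row word of a list of rows. -/
def rowWord (T : List (List ℤ)) : List ℤ := T.reverse.flatten

@[simp] theorem rowWord_nil : rowWord [] = [] := rfl

@[simp] theorem rowWord_cons (r : List ℤ) (T : List (List ℤ)) :
    rowWord (r :: T) = rowWord T ++ r := by simp [rowWord]

theorem rowWord_append (S T : List (List ℤ)) : rowWord (S ++ T) = rowWord T ++ rowWord S := by
  simp [rowWord]

theorem mem_rowWord {x : ℤ} {T : List (List ℤ)} : x ∈ rowWord T ↔ ∃ r ∈ T, x ∈ r := by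
  simp [rowWord]

theorem placticEquiv_insertRows {T : List (List ℤ)} (hT : IsTableau T) (x : ℤ) :
    PlacticEquiv (rowWord (insertRows x T)) (rowWord T ++ [x]) := by
  induction T generalizing x with
  | nil => exact .refl _
  | cons r rs ih =>
    obtain ⟨_, h2, _, h4⟩ := isTableau_cons.1 hT
    simp only [insertRows, rowWord_cons]
    rcases h : (rowInsert x r).2 with _ | y
    · rw [rowInsert_eq_append h, List.append_assoc]
      exact .refl _
    · have h1 := (ih h4 y).append_right (rowInsert x r).1
      refine h1.trans ?_
      rw [List.append_assoc, List.append_assoc]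
      exact ((placticEquiv_rowInsert h2 h).symm).append_left _

theorem placticEquiv_insertWord {T : List (List ℤ)} (hT : IsTableau T) (w : List ℤ) :
    PlacticEquiv (rowWord (insertWord T w)) (rowWord T ++ w) := by
  induction w generalizing T with
  | nil => simpa using PlacticEquiv.refl _
  | cons x w ih =>
    have := (ih (hT.insertRows x)).trans ((placticEquiv_insertRows hT x).append_right w)
    simpa using this

theorem rowInsert_perm (x : ℤ) (r : List ℤ) :
    ((rowInsert x r).2.toList ++ (rowInsert x r).1).Perm (x :: r) := by
  induction r with
  | nil => simp [rowInsert]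
  | cons k r ih =>
    by_cases hx : x < k
    · simpa [rowInsert, hx] using List.Perm.swap x k r
    · simp only [rowInsert, hx, if_false]
      exact List.perm_middle.trans ((ih.cons k).trans (List.Perm.swap x k r))

theorem rowWord_insertRows_perm (x : ℤ) (T : List (List ℤ)) :
    (rowWord (insertRows x T)).Perm (x :: rowWord T) := by
  induction T generalizing x with
  | nil => simp [insertRows, rowWord]
  | cons r rs ih =>
    simp only [insertRows, rowWord_cons]
    have hp := rowInsert_perm x r
    rcases h : (rowInsert x r).2 with _ | y
    · rw [h] at hp
      exact (hp.append_left _).trans List.perm_middle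
    · rw [h] at hp
      have h1 : (rowWord rs ++ y :: (rowInsert x r).1).Perm (rowWord rs ++ x :: r) :=
        hp.append_left _
      exact ((ih y).append_right _).trans (List.perm_middle.symm.trans (h1.trans List.perm_middle))

theorem rowWord_insertWord_perm (T : List (List ℤ)) (w : List ℤ) :
    (rowWord (insertWord T w)).Perm (w ++ rowWord T) := by
  induction w generalizing T with
  | nil => simp
  | cons x w ih =>
    exact (ih _).trans (((rowWord_insertRows_perm x T).append_left w).trans List.perm_middle)

/-! ### Insertion of increasing rows -/

/-- Inserting a weakly increasing row `x` in a row `q` whose entries exceed those of `x` bumps out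
the first entries of `q`. -/
theorem rowInsertWord_of_colLT {x q : List ℤ} (hx : x.Pairwise (· ≤ ·))
    (h : ColLT x (q.take x.length)) :
    rowInsertWord q x = (x ++ q.drop x.length, q.take x.length) := by
  induction x generalizing q with
  | nil => simp [rowInsertWord]
  | cons x0 xs ih =>
    rw [List.pairwise_cons] at hx
    cases q with
    | nil =>
      have := ih (q := []) hx.2 (by simp [ColLT])
      simp [rowInsertWord, rowInsert, rowInsertWord_cons_of_le hx.1, this]
    | cons q0 qs =>
      simp only [List.length_cons, List.take_succ_cons, ColLT] at h
      simp [rowInsertWord, rowInsert, h.1, rowInsertWord_cons_of_le hx.1, ih hx.2 h.2]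

theorem ColLT.length_le : ∀ {r s : List ℤ}, ColLT r s → s.length ≤ r.length
  | _, [], _ => by simp
  | [], _ :: _, h => by simp [ColLT] at h
  | _ :: _, _ :: _, h => by simpa using h.2.length_le

theorem insertWord_row_nil {x : List ℤ} (hx : x.Pairwise (· ≤ ·)) (hne : x ≠ []) :
    insertWord [] x = [x] := by
  have h := rowInsertWord_of_colLT (q := []) hx (by simp [ColLT])
  rw [insertWord_nil_rows hne, h]
  simp

theorem exists_lt_of_colLT : ∀ {r s : List ℤ}, ColLT r s → ∀ y ∈ s, ∃ x ∈ r, x < y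
  | _, [], _, _, h => by simp at h
  | [], _ :: _, h, _, _ => by simp [ColLT] at h
  | x :: r, z :: s, h, y, hy => by
    rcases List.mem_cons.1 hy with rfl | hy
    · exact ⟨x, by simp, h.1⟩
    · obtain ⟨w, hw, hlt⟩ := exists_lt_of_colLT h.2 y hy
      exact ⟨w, by simp [hw], hlt⟩

/-- Rows of two lists of rows put next to each other. -/
def glueRows : List (List ℤ) → List (List ℤ) → List (List ℤ)
  | [], P => P
  | L, [] => L
  | l :: L, p :: P => (l ++ p) :: glueRows L P

/-- Each entry of a row of `L` is at most each entry of the same row of `P`. -/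
def RowLE : List (List ℤ) → List (List ℤ) → Prop
  | [], _ => True
  | _, [] => True
  | l :: L, p :: P => (∀ x ∈ l, ∀ y ∈ p, x ≤ y) ∧ RowLE L P

@[simp] theorem glueRows_nil_left (P : List (List ℤ)) : glueRows [] P = P := by
  cases P <;> rfl

@[simp] theorem glueRows_nil_right (L : List (List ℤ)) : glueRows L [] = L := by
  cases L <;> rfl

@[simp] theorem rowLE_nil_left (P : List (List ℤ)) : RowLE [] P := by
  cases P <;> trivial

@[simp] theorem rowLE_nil_right (L : List (List ℤ)) : RowLE L [] := by
  cases L <;> trivial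

theorem RowLE.shift {L P : List (List ℤ)} {x : List ℤ} (hP : IsTableau (x :: P))
    (h : RowLE L (x :: P)) : RowLE L P := by
  induction P generalizing L x with
  | nil => simp
  | cons p P ih =>
    cases L with
    | nil => simp
    | cons l L =>
      obtain ⟨_, _, h3, h4⟩ := isTableau_cons.1 hP
      refine ⟨fun u hu v hv => ?_, ih h4 h.2⟩
      obtain ⟨w, hw, hlt⟩ := exists_lt_of_colLT (h3 p (by simp)) v hv
      exact (h.1 u hu w hw).trans hlt.le

theorem insertWord_glueRows_row {L P : List (List ℤ)} {x : List ℤ} (hP : IsTableau (x :: P))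
    (h : RowLE L (x :: P)) : insertWord (glueRows L P) x = glueRows L (x :: P) := by
  induction P generalizing L x with
  | nil =>
    obtain ⟨h1, h2, _, _⟩ := isTableau_cons.1 hP
    cases L with
    | nil => simpa using insertWord_row_nil h2 h1
    | cons l L =>
      have e := rowInsertWord_append_of_le h.1 []
      rw [rowInsertWord_of_colLT (q := []) h2 (by simp [ColLT])] at e
      simp only [List.append_nil] at e
      simp [glueRows, insertWord_rows_cons, e]
  | cons p P ih =>
    obtain ⟨_, h2, h3, h4⟩ := isTableau_cons.1 hP
    have hc := h3 p (by simp)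
    have hl := hc.length_le
    have e := rowInsertWord_of_colLT (q := p) h2 (by rwa [List.take_of_length_le hl])
    rw [List.take_of_length_le hl, List.drop_of_length_le hl, List.append_nil] at e
    cases L with
    | nil =>
      have := ih (L := []) h4 (by simp)
      simp only [glueRows_nil_left] at this ⊢
      rw [insertWord_rows_cons, e, this]
    | cons l L =>
      simp only [glueRows]
      rw [insertWord_rows_cons, rowInsertWord_append_of_le h.1, e, ih h4 h.2]

/-- If the rows of a tableau can be put to the right of the rows of `L`, then this is the result of
inserting the word of the tableau in `L`. -/
theorem insertWord_rowWord {L P : List (List ℤ)} (hP : IsTableau P) (h : RowLE L P) :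
    insertWord L (rowWord P) = glueRows L P := by
  induction P generalizing L with
  | nil => simp
  | cons x P ih =>
    rw [rowWord_cons, insertWord_append, ih (isTableau_cons.1 hP).2.2.2 (h.shift hP),
      insertWord_glueRows_row hP h]

theorem insertWord_nil_rowWord {P : List (List ℤ)} (hP : IsTableau P) :
    insertWord [] (rowWord P) = P := by
  rw [insertWord_rowWord hP (by simp), glueRows_nil_left]

/-! ### The semigroup of tableaux -/

namespace Tableau

theorem word_eq (T : Tableau) : T.word = rowWord T.rows := rfl

theorem mul_rows (T U : Tableau) : (T * U).rows = insertWord T.rows (rowWord U.rows) := rfl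

@[simp] theorem empty_rows : (∅ : Tableau).rows = [] := rfl

theorem placticEquiv_mul (T U : Tableau) :
    PlacticEquiv (rowWord (T * U).rows) (rowWord T.rows ++ rowWord U.rows) :=
  placticEquiv_insertWord T.isTableau _

/-- Associativity holds because the word of `U * V` and the concatenation of the words of `U` and
`V` have the same effect when inserted in `T`. -/
instance : Semigroup Tableau where
  mul_assoc T U V := by
    ext1
    simp only [mul_rows]
    have := placticEquiv_mul U V T.rows T.isTableau
    rw [mul_rows] at this
    rw [this, insertWord_append]

@[simp] theorem mul_empty (T : Tableau) : T * ∅ = T := rfl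

@[simp] theorem empty_mul (T : Tableau) : ∅ * T = T := by
  ext1
  exact insertWord_nil_rowWord T.isTableau

/-- The tableau obtained by inserting a word in the empty tableau. -/
def ofWord (w : List ℤ) : Tableau := ⟨insertWord [] w, isTableau_nil.insertWord w⟩

theorem ofWord_rows (w : List ℤ) : (ofWord w).rows = insertWord [] w := rfl

theorem ofWord_rowWord (T : Tableau) : ofWord (rowWord T.rows) = T :=
  Tableau.ext (insertWord_nil_rowWord T.isTableau)

theorem mul_ofWord_rows (T : Tableau) (w : List ℤ) :
    (T * ofWord w).rows = insertWord T.rows w := by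
  rw [mul_rows, ofWord_rows]
  simpa using placticEquiv_insertWord isTableau_nil w T.rows T.isTableau

theorem ofWord_append (u w : List ℤ) : ofWord (u ++ w) = ofWord u * ofWord w := by
  ext1
  rw [mul_ofWord_rows, ofWord_rows, ofWord_rows, insertWord_append]

theorem _root_.PlacticEquiv.ofWord_eq {u w : List ℤ} (h : PlacticEquiv u w) :
    ofWord u = ofWord w := Tableau.ext (h [] isTableau_nil)

@[simp] theorem ofWord_nil : ofWord [] = ∅ := rfl

theorem mul_word_perm (T U : Tableau) : (T * U).word.Perm (U.word ++ T.word) :=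
  rowWord_insertWord_perm _ _

theorem mem_mul_word {T U : Tableau} {x : ℤ} : x ∈ (T * U).word ↔ x ∈ T.word ∨ x ∈ U.word := by
  rw [(mul_word_perm T U).mem_iff, List.mem_append, or_comm]

theorem word_length_mul (T U : Tableau) :
    (T * U).word.length = T.word.length + U.word.length := by
  rw [(mul_word_perm T U).length_eq, List.length_append, add_comm]

theorem eq_empty_of_word {T : Tableau} (h : T.word.length = 0) : T = ∅ := by
  rw [← ofWord_rowWord T, ← word_eq, List.length_eq_zero_iff.1 h, ofWord_nil]

theorem mul_eq_empty {T U : Tableau} (h : T * U = ∅) : T = ∅ ∧ U = ∅ := by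
  have := word_length_mul T U
  rw [h] at this
  change 0 = _ at this
  exact ⟨eq_empty_of_word (by omega), eq_empty_of_word (by omega)⟩

end Tableau

/-! ### Cutting tableaux along rows and columns -/

theorem ColLT.of_nil {s : List ℤ} (h : ColLT [] s) : s = [] := by
  cases s with
  | nil => rfl
  | cons y s => exact absurd h (by simp [ColLT])

theorem filter_ne_nil_eq_self {l : List (List ℤ)} (h : ∀ r ∈ l, r ≠ []) :
    l.filter (· ≠ []) = l := List.filter_eq_self.2 fun r hr => by simpa using h r hr

theorem filter_ne_nil_eq_nil {l : List (List ℤ)} (h : ∀ r ∈ l, r = []) :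
    l.filter (· ≠ []) = [] := List.filter_eq_nil_iff.2 fun r hr => by simpa using h r hr

/-- By `ColLT` only empty rows can follow an empty row, so discarding empty rows does not disturb
the numbering of the others. Hence cuts along rows and along columns commute. -/
theorem filter_ne_nil_take {l : List (List ℤ)} (h : l.Pairwise ColLT) (a : ℕ) :
    (l.take a).filter (· ≠ []) = (l.filter (· ≠ [])).take a := by
  induction l generalizing a with
  | nil => simp
  | cons r l ih =>
    rw [List.pairwise_cons] at h
    cases a with
    | zero => simp
    | succ a =>
      by_cases hr : r = []
      · subst hr
        have h0 : ∀ s ∈ l, s = [] := fun s hs => (h.1 s hs).of_nil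
        rw [filter_ne_nil_eq_nil (l := [] :: l) (by simpa using h0),
          filter_ne_nil_eq_nil (by
            intro s hs
            have := List.mem_of_mem_take hs
            simp only [List.mem_cons] at this
            exact this.elim id (h0 s))]
        simp
      · rw [List.take_succ_cons, List.filter_cons_of_pos (by simpa using hr),
          List.filter_cons_of_pos (by simpa using hr), ih h.2, List.take_succ_cons]

theorem filter_ne_nil_drop {l : List (List ℤ)} (h : l.Pairwise ColLT) (a : ℕ) :
    (l.drop a).filter (· ≠ []) = (l.filter (· ≠ [])).drop a := by
  induction l generalizing a with
  | nil => simp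
  | cons r l ih =>
    rw [List.pairwise_cons] at h
    cases a with
    | zero => simp
    | succ a =>
      by_cases hr : r = []
      · subst hr
        have h0 : ∀ s ∈ l, s = [] := fun s hs => (h.1 s hs).of_nil
        rw [filter_ne_nil_eq_nil (l := [] :: l) (by simpa using h0),
          filter_ne_nil_eq_nil (by
            intro s hs
            have := List.mem_of_mem_drop hs
            simp only [List.mem_cons] at this
            exact this.elim id (h0 s))]
        simp
      · rw [List.drop_succ_cons, List.filter_cons_of_pos (by simpa using hr), ih h.2,
          List.drop_succ_cons]

theorem filter_ne_nil_map_filter (l : List (List ℤ)) {f : List ℤ → List ℤ} (hf : f [] = []) :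
    ((l.filter (· ≠ [])).map f).filter (· ≠ []) = (l.map f).filter (· ≠ []) := by
  induction l with
  | nil => rfl
  | cons r l ih =>
    by_cases hr : r = []
    · subst hr
      rw [List.filter_cons_of_neg (by simp), ih, List.map_cons, hf,
        List.filter_cons_of_neg (by simp)]
    · rw [List.filter_cons_of_pos (by simpa using hr), List.map_cons, List.map_cons,
        List.filter_cons, List.filter_cons, ih]

namespace Tableau

theorem top_rows (a : ℕ) (T : Tableau) : (T.top a).rows = T.rows.take a := rfl

theorem below_rows (a : ℕ) (T : Tableau) : (T.below a).rows = T.rows.drop a := rfl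

theorem left_rows (b : ℕ) (T : Tableau) :
    (T.left b).rows = (T.rows.map (List.take b)).filter (· ≠ []) := rfl

theorem right_rows (b : ℕ) (T : Tableau) :
    (T.right b).rows = (T.rows.map (List.drop b)).filter (· ≠ []) := rfl

@[simp] theorem top_empty (a : ℕ) : (∅ : Tableau).top a = ∅ := Tableau.ext (by simp [top_rows])

@[simp] theorem below_empty (a : ℕ) : (∅ : Tableau).below a = ∅ :=
  Tableau.ext (by simp [below_rows])

@[simp] theorem left_empty (b : ℕ) : (∅ : Tableau).left b = ∅ := rfl

@[simp] theorem right_empty (b : ℕ) : (∅ : Tableau).right b = ∅ := rfl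

@[simp] theorem left_zero (T : Tableau) : T.left 0 = ∅ :=
  Tableau.ext (filter_ne_nil_eq_nil (by simp))

@[simp] theorem right_zero (T : Tableau) : T.right 0 = T :=
  Tableau.ext (by
    rw [right_rows, show List.drop 0 = (id : List ℤ → List ℤ) from rfl, List.map_id]
    exact filter_ne_nil_eq_self T.isTableau.ne_nil)

theorem left_rows_of_pos {b : ℕ} (hb : 0 < b) (T : Tableau) :
    (T.left b).rows = T.rows.map (List.take b) := by
  refine filter_ne_nil_eq_self fun r hr => ?_
  obtain ⟨s, hs, rfl⟩ := List.mem_map.1 hr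
  have := T.isTableau.ne_nil s hs
  simp [this]; omega

theorem left_top (a b : ℕ) (T : Tableau) : (T.top a).left b = (T.left b).top a := by
  ext1
  rw [left_rows, top_rows, top_rows, left_rows, List.map_take,
    filter_ne_nil_take (T.isTableau.col_strict.map _ fun _ _ h => h.take b)]

theorem left_below (a b : ℕ) (T : Tableau) : (T.below a).left b = (T.left b).below a := by
  ext1
  rw [left_rows, below_rows, below_rows, left_rows, List.map_drop,
    filter_ne_nil_drop (T.isTableau.col_strict.map _ fun _ _ h => h.take b)]

theorem right_top (a b : ℕ) (T : Tableau) : (T.top a).right b = (T.right b).top a := by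
  ext1
  rw [right_rows, top_rows, top_rows, right_rows, List.map_take,
    filter_ne_nil_take (T.isTableau.col_strict.map _ fun _ _ h => h.drop b)]

theorem right_below (a b : ℕ) (T : Tableau) : (T.below a).right b = (T.right b).below a := by
  ext1
  rw [right_rows, below_rows, below_rows, right_rows, List.map_drop,
    filter_ne_nil_drop (T.isTableau.col_strict.map _ fun _ _ h => h.drop b)]

theorem left_left {b c : ℕ} (h : b ≤ c) (T : Tableau) : (T.left c).left b = T.left b := by
  ext1
  rw [left_rows, left_rows, filter_ne_nil_map_filter _ (by simp), List.map_map, left_rows]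
  congr 2
  funext r
  simp [List.take_take, h]

theorem right_right (b c : ℕ) (T : Tableau) : (T.right b).right c = T.right (b + c) := by
  ext1
  rw [right_rows, right_rows, filter_ne_nil_map_filter _ (by simp), List.map_map, right_rows]
  congr 2
  funext r
  simp

theorem right_left (b c : ℕ) (T : Tableau) :
    (T.left (b + c)).right b = (T.right b).left c := by
  ext1
  rw [right_rows, left_rows, filter_ne_nil_map_filter _ (by simp), List.map_map, left_rows,
    right_rows, filter_ne_nil_map_filter _ (by simp), List.map_map]
  congr 2
  funext r
  simp [List.drop_take]

@[simp] theorem right_left_self (b : ℕ) (T : Tableau) : (T.left b).right b = ∅ := by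
  simpa using right_left b 0 T

@[simp] theorem left_left_self (b : ℕ) (T : Tableau) : (T.left b).left b = T.left b :=
  left_left le_rfl T

theorem top_top {a c : ℕ} (h : a ≤ c) (T : Tableau) : (T.top c).top a = T.top a := by
  ext1; simp [top_rows, List.take_take, h]

@[simp] theorem below_top_self (a : ℕ) (T : Tableau) : (T.top a).below a = ∅ := by
  ext1; simp [top_rows, below_rows]

@[simp] theorem below_mul_top (a : ℕ) (T : Tableau) : T.below a * T.top a = T := by
  rw [← ofWord_rowWord (T.below a), ← ofWord_rowWord (T.top a), ← ofWord_append, below_rows,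
    top_rows, ← rowWord_append, List.take_append_drop, ofWord_rowWord]

theorem below_of_le {a c : ℕ} (h : a ≤ c) (T : Tableau) :
    T.below a = T.below c * (T.top c).below a := by
  rw [← below_mul_top (c - a) (T.below a)]
  congr 1
  · ext1; simp [below_rows, h]
  · ext1; simp [below_rows, top_rows, List.drop_take]

theorem mem_below {a : ℕ} {T : Tableau} {x : ℤ} (h : x ∈ (T.below a).word) : x ∈ T.word := by
  rw [← below_mul_top a T]; exact mem_mul_word.2 (.inl h)

end Tableau

/-! ### Tableaux next to each other -/

/-- All rows of `L` have length at most `b`, and a row of `R` can be put next to the row of `L` with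
the same number, which must have length `b`. -/
def Beside (b : ℕ) : List (List ℤ) → List (List ℤ) → Prop
  | L, [] => ∀ l ∈ L, l.length ≤ b
  | [], _ :: _ => False
  | l :: L, r :: R => l.length = b ∧ (∀ x ∈ l, ∀ y ∈ r, x ≤ y) ∧ Beside b L R

theorem beside_nil_right {b : ℕ} {L : List (List ℤ)} :
    Beside b L [] ↔ ∀ l ∈ L, l.length ≤ b := by cases L <;> rfl

theorem Beside.length_le {b : ℕ} : ∀ {L R : List (List ℤ)}, Beside b L R → ∀ l ∈ L, l.length ≤ b
  | _, [], h => beside_nil_right.1 h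
  | [], _ :: _, _ => by simp
  | l :: L, r :: R, h => by
    intro k hk
    rcases List.mem_cons.1 hk with rfl | hk
    · exact h.1.le
    · exact h.2.2.length_le k hk

theorem Beside.rowLE {b : ℕ} : ∀ {L R : List (List ℤ)}, Beside b L R → RowLE L R
  | _, [], _ => by simp
  | [], _ :: _, _ => by simp
  | _ :: _, _ :: _, h => ⟨h.2.1, h.2.2.rowLE⟩

theorem Beside.map_take_glueRows {b : ℕ} :
    ∀ {L R : List (List ℤ)}, Beside b L R → (glueRows L R).map (List.take b) = L
  | L, [], h => by
    rw [glueRows_nil_right]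
    exact (List.map_congr_left fun l hl => List.take_of_length_le (h.length_le l hl)).trans
      (List.map_id L)
  | [], _ :: _, h => h.elim
  | l :: L, r :: R, h => by
    obtain ⟨rfl, _, h3⟩ := h
    simp [glueRows, h3.map_take_glueRows]

theorem Beside.filter_map_drop_glueRows {b : ℕ} :
    ∀ {L R : List (List ℤ)}, Beside b L R → (∀ r ∈ R, r ≠ []) →
      ((glueRows L R).map (List.drop b)).filter (· ≠ []) = R
  | L, [], h, _ => by
    rw [glueRows_nil_right]
    refine filter_ne_nil_eq_nil fun r hr => ?_
    obtain ⟨l, hl, rfl⟩ := List.mem_map.1 hr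
    exact List.drop_of_length_le (h.length_le l hl)
  | [], _ :: _, h, _ => h.elim
  | l :: L, r :: R, h, hR => by
    obtain ⟨rfl, _, h3⟩ := h
    rw [glueRows, List.map_cons, List.drop_left, List.filter_cons_of_pos (by simpa using hR r),
      h3.filter_map_drop_glueRows fun s hs => hR s (by simp [hs])]

/-- The rows of `R` start with entries at most those of the rows of `S`, and `R` has at least as
many rows. -/
def HeadLE : List (List ℤ) → List (List ℤ) → Prop
  | _, [] => True
  | [], _ :: _ => False
  | r :: R, s :: S => (∀ y ∈ s, ∃ x ∈ r, x ≤ y) ∧ HeadLE R S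

theorem HeadLE.refl : ∀ R : List (List ℤ), HeadLE R R
  | [] => trivial
  | _ :: R => ⟨fun y hy => ⟨y, hy, le_rfl⟩, HeadLE.refl R⟩

theorem HeadLE.trans : ∀ {R S U : List (List ℤ)}, HeadLE R S → HeadLE S U → HeadLE R U
  | _, _, [], _, _ => by simp [HeadLE]
  | _, [], _ :: _, _, h => by simp [HeadLE] at h
  | [], _ :: _, _ :: _, h, _ => by simp [HeadLE] at h
  | r :: R, s :: S, u :: U, h, h' =>
    ⟨fun z hz => by
      obtain ⟨y, hy, hyz⟩ := h'.1 z hz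
      obtain ⟨x, hx, hxy⟩ := h.1 y hy
      exact ⟨x, hx, hxy.trans hyz⟩, h.2.trans h'.2⟩

theorem Beside.mono {b : ℕ} : ∀ {L R S : List (List ℤ)}, Beside b L R → HeadLE R S → Beside b L S
  | _, _, [], h, _ => beside_nil_right.2 h.length_le
  | _, [], _ :: _, _, h => by simp [HeadLE] at h
  | [], _ :: _, _ :: _, h, _ => h.elim
  | _ :: _, _ :: _, _ :: _, h, h' =>
    ⟨h.1, fun x hx y hy => by
      obtain ⟨z, hz, hzy⟩ := h'.1 y hy
      exact (h.2.1 x hx z hz).trans hzy, h.2.2.mono h'.2⟩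

theorem Beside.append {b : ℕ} {S : List (List ℤ)} (hS : ∀ l ∈ S, l.length ≤ b) :
    ∀ {L R : List (List ℤ)}, Beside b L R → Beside b (L ++ S) R
  | _, [], h => beside_nil_right.2 fun l hl => (List.mem_append.1 hl).elim (h.length_le l) (hS l)
  | [], _ :: _, h => h.elim
  | _ :: _, _ :: _, h => ⟨h.1, h.2.1, h.2.2.append hS⟩

theorem exists_le_mem_rowInsert (x : ℤ) {y : ℤ} {r : List ℤ} (hy : y ∈ r) :
    ∃ z ∈ (rowInsert x r).1, z ≤ y := by
  induction r with
  | nil => simp at hy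
  | cons k r ih =>
    by_cases hx : x < k
    · rcases List.mem_cons.1 hy with rfl | hy
      · exact ⟨x, by simp [rowInsert, hx], hx.le⟩
      · exact ⟨y, by simp [rowInsert, hx, hy], le_rfl⟩
    · rcases List.mem_cons.1 hy with rfl | hy
      · exact ⟨y, by simp [rowInsert, hx], le_rfl⟩
      · obtain ⟨z, hz, hzy⟩ := ih hy
        exact ⟨z, by simp [rowInsert, hx, hz], hzy⟩

theorem headLE_insertRows (x : ℤ) (T : List (List ℤ)) : HeadLE (insertRows x T) T := by
  induction T generalizing x with
  | nil => trivial
  | cons r rs ih =>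
    refine ⟨fun y hy => exists_le_mem_rowInsert x hy, ?_⟩
    rcases (rowInsert x r).2 with _ | y
    · exact .refl _
    · exact ih y

/-- Bumping only lowers entries and never removes boxes. Together with `Beside.mono`, whatever lets
a product stand to the right of `L` also lets its left factor stand there. -/
theorem headLE_insertWord (T : List (List ℤ)) (w : List ℤ) : HeadLE (insertWord T w) T := by
  induction w generalizing T with
  | nil => exact .refl _
  | cons x w ih => exact (ih _).trans (headLE_insertRows x T)

namespace Tableau

theorem mul_rows_of_beside {b : ℕ} {L R : Tableau} (h : Beside b L.rows R.rows) :
    (L * R).rows = glueRows L.rows R.rows := insertWord_rowWord R.isTableau h.rowLE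

theorem left_mul_of_beside {b : ℕ} {L R : Tableau} (h : Beside b L.rows R.rows) :
    (L * R).left b = L := by
  ext1
  rw [left_rows, mul_rows_of_beside h, h.map_take_glueRows,
    filter_ne_nil_eq_self L.isTableau.ne_nil]

theorem right_mul_of_beside {b : ℕ} {L R : Tableau} (h : Beside b L.rows R.rows) :
    (L * R).right b = R := by
  ext1
  rw [right_rows, mul_rows_of_beside h, h.filter_map_drop_glueRows R.isTableau.ne_nil]

theorem beside_map_take_drop (b : ℕ) {rows : List (List ℤ)} (h : IsTableau rows) :
    Beside b (rows.map (List.take b)) ((rows.map (List.drop b)).filter (· ≠ [])) ∧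
      glueRows (rows.map (List.take b)) ((rows.map (List.drop b)).filter (· ≠ [])) = rows := by
  induction rows with
  | nil => exact ⟨by simp [Beside], rfl⟩
  | cons r rs ih =>
    obtain ⟨h1, h2, h3, h4⟩ := isTableau_cons.1 h
    by_cases hr : r.length ≤ b
    · have hall : ∀ s ∈ r :: rs, s.length ≤ b := by
        intro s hs
        rcases List.mem_cons.1 hs with rfl | hs
        · exact hr
        · exact (h3 s hs).length_le.trans hr
      have hnil : ((r :: rs).map (List.drop b)).filter (· ≠ []) = [] := by
        refine filter_ne_nil_eq_nil fun s hs => ?_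
        obtain ⟨l, hl, rfl⟩ := List.mem_map.1 hs
        exact List.drop_of_length_le (hall l hl)
      rw [hnil, beside_nil_right, glueRows_nil_right]
      refine ⟨fun l hl => ?_, ?_⟩
      · obtain ⟨s, _, rfl⟩ := List.mem_map.1 hl
        simp
      · exact (List.map_congr_left fun l hl => List.take_of_length_le (hall l hl)).trans
          (List.map_id _)
    · have hd : List.drop b r ≠ [] := by simpa using hr
      rw [List.map_cons, List.map_cons, List.filter_cons_of_pos (by simpa using hd)]
      refine ⟨⟨by simp; omega, ?_, (ih h4).1⟩, by rw [glueRows, List.take_append_drop, (ih h4).2]⟩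
      rw [← List.take_append_drop b r, List.pairwise_append] at h2
      exact h2.2.2

theorem beside_left_right {b : ℕ} (hb : 0 < b) (T : Tableau) :
    Beside b (T.left b).rows (T.right b).rows := by
  rw [left_rows_of_pos hb, right_rows]
  exact (beside_map_take_drop b T.isTableau).1

@[simp] theorem left_mul_right (b : ℕ) (T : Tableau) : T.left b * T.right b = T := by
  rcases Nat.eq_zero_or_pos b with rfl | hb
  · simp
  · ext1
    rw [mul_rows_of_beside (beside_left_right hb T), left_rows_of_pos hb, right_rows,
      (beside_map_take_drop b T.isTableau).2]

theorem eq_of_left_right {S T : Tableau} (b : ℕ) (h : S.left b = T.left b)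
    (h' : S.right b = T.right b) : S = T := by
  rw [← left_mul_right b S, h, h', left_mul_right]

theorem right_of_le {b c : ℕ} (h : b ≤ c) (T : Tableau) :
    T.right b = (T.left c).right b * T.right c := by
  obtain ⟨d, rfl⟩ := Nat.exists_eq_add_of_le h
  rw [right_left, ← right_right, left_mul_right]

theorem mem_left {b : ℕ} {T : Tableau} {x : ℤ} (h : x ∈ (T.left b).word) : x ∈ T.word := by
  rw [← left_mul_right b T]; exact mem_mul_word.2 (.inl h)

theorem mem_right {b : ℕ} {T : Tableau} {x : ℤ} (h : x ∈ (T.right b).word) : x ∈ T.word := by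
  rw [← left_mul_right b T]; exact mem_mul_word.2 (.inr h)

/-- If the part of `Q` right of column `b` is a product `C * E`, then `C` fits to the right of the
first `b` columns of `Q`. -/
theorem beside_left_factor {b : ℕ} {Q C E : Tableau} (h : Q.right b = C * E) :
    (Q.left b * C).left b = Q.left b ∧ (Q.left b * C).right b = C := by
  rcases Nat.eq_zero_or_pos b with rfl | hb
  · simp
  · have h1 := beside_left_right hb Q
    rw [h] at h1
    have h2 := h1.mono (headLE_insertWord C.rows (rowWord E.rows))
    exact ⟨left_mul_of_beside h2, right_mul_of_beside h2⟩

end Tableau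

/-! ### Column insertion -/

/-- Column bumping in one column. -/
def colInsert (x : ℤ) : List ℤ → List ℤ × Option ℤ
  | [] => ([x], none)
  | y :: c => if x ≤ y then (x :: c, some y) else (y :: (colInsert x c).1, (colInsert x c).2)

/-- The column `d` can stand to the right of the column `c`. -/
def ColLE : List ℤ → List ℤ → Prop
  | _, [] => True
  | [], _ :: _ => False
  | x :: c, y :: d => x ≤ y ∧ ColLE c d

theorem le_of_colInsert {x y : ℤ} {c : List ℤ} (h : (colInsert x c).2 = some y) : x ≤ y := by
  induction c with
  | nil => simp [colInsert] at h
  | cons z c ih =>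
    simp only [colInsert] at h
    split at h
    · simp_all
    · exact ih h

theorem ColLE.colInsert_left (x : ℤ) : ∀ {c d : List ℤ}, ColLE c d → ColLE (colInsert x c).1 d
  | _, [], _ => by simp [ColLE]
  | [], _ :: _, h => by simp [ColLE] at h
  | y :: c, z :: d, h => by
    simp only [colInsert]
    split
    · rename_i hxy; exact ⟨hxy.trans h.1, h.2⟩
    · exact ⟨h.1, h.2.colInsert_left x⟩

theorem ColLE.colInsert_both {x y : ℤ} : ∀ {c d : List ℤ}, ColLE c d →
    (colInsert x c).2 = some y → ColLE (colInsert x c).1 (colInsert y d).1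
  | [], _, _, h => by simp [colInsert] at h
  | z :: c, [], _, h => by
    have hxy := le_of_colInsert h
    simp only [colInsert] at h ⊢
    split
    · simp [ColLE, hxy]
    · rename_i hxz; simp only [ColLE, and_true]; omega
  | z :: c, w :: d, hc, h => by
    have hxy := le_of_colInsert h
    obtain ⟨hzw, hc⟩ := hc
    simp only [colInsert] at h
    split at h
    · rename_i hxz
      simp only [Option.some.injEq] at h
      subst h
      simp only [colInsert, hxz, hzw, if_true]
      exact ⟨hxy, hc⟩
    · rename_i hxz
      simp only [colInsert, hxz, if_false]
      split
      · exact ⟨by omega, hc.colInsert_left x⟩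
      · exact ⟨hzw, hc.colInsert_both h⟩

theorem mem_colInsert {x z : ℤ} {c : List ℤ} (h : z ∈ (colInsert x c).1) : z = x ∨ z ∈ c := by
  induction c with
  | nil => simpa [colInsert] using h
  | cons y c ih =>
    simp only [colInsert] at h
    split at h
    · simp only [List.mem_cons] at h ⊢; tauto
    · simp only [List.mem_cons] at h ⊢
      rcases h with h | h
      · tauto
      · have := ih h; tauto

theorem colInsert_sorted (x : ℤ) {c : List ℤ} (h : c.Pairwise (· < ·)) :
    (colInsert x c).1.Pairwise (· < ·) := by
  induction c with
  | nil => simp [colInsert]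
  | cons y c ih =>
    rw [List.pairwise_cons] at h
    simp only [colInsert]
    split
    · rename_i hxy
      exact List.pairwise_cons.2 ⟨fun z hz => hxy.trans_lt (h.1 z hz), h.2⟩
    · rename_i hxy
      refine List.pairwise_cons.2 ⟨fun z hz => ?_, ih h.2⟩
      rcases mem_colInsert hz with rfl | hz
      · exact not_le.1 hxy
      · exact h.1 z hz

theorem colInsert_eq_append {x : ℤ} {c : List ℤ} (h : (colInsert x c).2 = none) :
    (colInsert x c).1 = c ++ [x] := by
  induction c with
  | nil => rfl
  | cons k c ih =>
    by_cases hx : x ≤ k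
    · simp [colInsert, hx] at h
    · simp only [colInsert, hx, if_false] at h ⊢
      rw [ih h]; rfl

theorem head_colInsert_le {x y : ℤ} {c : List ℤ} (h : (colInsert x c).2 = some y) :
    ∃ e s, (colInsert x c).1 = e :: s ∧ e ≤ x := by
  cases c with
  | nil => simp [colInsert] at h
  | cons k c =>
    by_cases hx : x ≤ k
    · exact ⟨x, c, by simp [colInsert, hx], le_rfl⟩
    · exact ⟨k, _, by simp [colInsert, hx]; rfl, (not_le.1 hx).le⟩

theorem placticEquiv_move_right {x d : ℤ} {c : List ℤ} (hx : x ≤ d)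
    (hc : (d :: c).Pairwise (· < ·)) :
    PlacticEquiv (x :: (c.reverse ++ [d])) (c.reverse ++ [x, d]) := by
  induction c generalizing d with
  | nil => exact .refl _
  | cons k c ih =>
    rw [List.pairwise_cons] at hc
    have hk : d < k := hc.1 k (by simp)
    have h1 := (ih (hx.trans hk.le) hc.2).append_right [d]
    have h2 := (Knuth.xzy hx hk).placticEquiv.append_left c.reverse
    simp only [List.reverse_cons, List.append_assoc, List.cons_append, List.nil_append] at h1 h2 ⊢
    exact h1.trans h2

/-- The mirror image of `placticEquiv_rowInsert`: a column is read from bottom to top, and the two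
types of Knuth relations exchange their roles. -/
theorem placticEquiv_colInsert {x y : ℤ} {c : List ℤ} (hc : c.Pairwise (· < ·))
    (h : (colInsert x c).2 = some y) :
    PlacticEquiv (x :: c.reverse) ((colInsert x c).1.reverse ++ [y]) := by
  induction c with
  | nil => simp [colInsert] at h
  | cons d c ih =>
    by_cases hx : x ≤ d
    · simp only [colInsert, hx, if_true, Option.some.injEq] at h ⊢
      subst h
      simpa using placticEquiv_move_right hx hc
    · have hs := colInsert_sorted x hc
      rw [List.pairwise_cons] at hc
      simp only [colInsert, hx, if_false] at h hs ⊢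
      have h1 := (ih hc.2 h).append_right [d]
      obtain ⟨e, s, hes, hex⟩ := head_colInsert_le h
      rw [hes] at h1 hs ⊢
      have hde : d < e := (List.pairwise_cons.1 hs).1 e (by simp)
      have h2 := (Knuth.yzx hde (hex.trans (le_of_colInsert h))).placticEquiv.append_left s.reverse
      simp only [List.reverse_cons, List.append_assoc, List.cons_append, List.nil_append] at h1 h2 ⊢
      exact h1.trans h2

theorem isTableau_column {c : List ℤ} (h : c.Pairwise (· < ·)) :
    IsTableau (c.map fun x => [x]) := by
  refine ⟨by simp, by simp, ?_⟩
  exact List.Pairwise.map _ (fun _ _ h => ⟨h, trivial⟩) h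

theorem rowWord_column (c : List ℤ) : rowWord (c.map fun x => [x]) = c.reverse := by
  induction c with
  | nil => rfl
  | cons x c ih => simp [ih]

theorem beside_column_iff : ∀ {c d : List ℤ},
    Beside 1 (c.map fun x => [x]) (d.map fun x => [x]) ↔ ColLE c d
  | _, [] => by simp [Beside, ColLE]
  | [], _ :: _ => by simp [Beside, ColLE]
  | x :: c, y :: d => by simp [Beside, ColLE, beside_column_iff (c := c) (d := d)]

theorem headLE_map_take {b : ℕ} (R : List (List ℤ)) : HeadLE R (R.map (List.take b)) := by
  induction R with
  | nil => trivial
  | cons r R ih => exact ⟨fun y hy => ⟨y, List.mem_of_mem_take hy, le_rfl⟩, ih⟩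

theorem map_take_headLE {R : List (List ℤ)} (h : IsTableau R) :
    HeadLE (R.map (List.take 1)) R := by
  induction R with
  | nil => trivial
  | cons r R ih =>
    obtain ⟨h1, h2, _, h4⟩ := isTableau_cons.1 h
    refine ⟨fun y hy => ?_, ih h4⟩
    cases r with
    | nil => exact absurd rfl h1
    | cons x r =>
      refine ⟨x, by simp, ?_⟩
      rcases List.mem_cons.1 hy with rfl | hy
      · exact le_rfl
      · exact (List.pairwise_cons.1 h2).1 y hy

namespace Tableau

/-- The tableau with a single column. -/
def column (c : List ℤ) (h : c.Pairwise (· < ·)) : Tableau := ⟨_, isTableau_column h⟩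

theorem column_eq_ofWord {c : List ℤ} (h : c.Pairwise (· < ·)) :
    column c h = ofWord c.reverse := by
  rw [← ofWord_rowWord (column c h), ← rowWord_column c]; rfl

theorem exists_left_one_eq_column (T : Tableau) : ∃ c h, T.left 1 = column c h := by
  have key : ∀ rows : List (List ℤ), IsTableau rows →
      ∃ c : List ℤ, rows.map (List.take 1) = c.map fun x => [x] := by
    intro rows h
    induction rows with
    | nil => exact ⟨[], rfl⟩
    | cons r rows ih =>
      obtain ⟨h1, _, _, h4⟩ := isTableau_cons.1 h
      obtain ⟨c, hc⟩ := ih h4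
      cases r with
      | nil => exact absurd rfl h1
      | cons x r => exact ⟨x :: c, by simp [hc]⟩
  obtain ⟨c, hc⟩ := key T.rows T.isTableau
  rw [← left_rows_of_pos one_pos] at hc
  refine ⟨c, ?_, Tableau.ext hc⟩
  have h := (T.left 1).isTableau.col_strict
  rw [hc, List.pairwise_map] at h
  exact h.imp fun h => h.1

/-- Column insertion: multiplying by a letter from the left changes the first column by column
bumping and multiplies the other columns by the bumped letter. -/
theorem letter_mul (x : ℤ) {T : Tableau} {c : List ℤ} {hc : c.Pairwise (· < ·)}
    (h : T.left 1 = column c hc) :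
    (ofWord [x] * T).left 1 = column (colInsert x c).1 (colInsert_sorted x hc) ∧
      (ofWord [x] * T).right 1 = ofWord (colInsert x c).2.toList * T.right 1 := by
  have hprod : ofWord [x] * T = column (colInsert x c).1 (colInsert_sorted x hc) *
      (ofWord (colInsert x c).2.toList * T.right 1) := by
    conv_lhs => rw [← left_mul_right 1 T, h]
    rw [← mul_assoc, ← mul_assoc, column_eq_ofWord, column_eq_ofWord, ← ofWord_append,
      ← ofWord_append]
    congr 1
    rcases hy : (colInsert x c).2 with _ | y
    · rw [colInsert_eq_append hy]; simp
    · exact (placticEquiv_colInsert hc hy).ofWord_eq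
  have hbes := beside_left_right one_pos T
  rw [h] at hbes
  -- The product is already written as the new column times the rest. Once the rest is known to fit
  -- beside that column, cutting after one column recovers the two factors.
  suffices hb : Beside 1 (column (colInsert x c).1 (colInsert_sorted x hc)).rows
      (ofWord (colInsert x c).2.toList * T.right 1).rows by
    rw [hprod]
    exact ⟨left_mul_of_beside hb, right_mul_of_beside hb⟩
  clear hprod
  rcases hy : (colInsert x c).2 with _ | y
  · simp only [Option.toList_none, ofWord_nil, empty_mul]
    simp only [colInsert_eq_append hy, column, List.map_append]
    exact hbes.append (by simp)
  · obtain ⟨d, hd, hd'⟩ := exists_left_one_eq_column (T.right 1)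
    have hlt : (T.right 1).word.length < T.word.length := by
      have h0 := word_length_mul (T.left 1) (T.right 1)
      rw [left_mul_right, h] at h0
      have : c ≠ [] := by rintro rfl; simp [colInsert] at hy
      have : (column c hc).word.length ≠ 0 := by
        rw [word_eq]
        simp [column, rowWord_column, this]
      omega
    -- The rest is again a letter times a tableau, with the nonempty column `c` removed. The
    -- recursive call identifies its first column, which is all that has to be compared with the new
    -- column.
    have ih := (letter_mul y hd').1
    have hcd : ColLE c d := by
      rw [← beside_column_iff]
      have := hbes.mono (headLE_map_take (b := 1) _)
      rwa [← left_rows_of_pos one_pos, hd'] at this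
    have h1 := beside_column_iff.2 (hcd.colInsert_both hy)
    refine Beside.mono h1 ?_
    have h2 := map_take_headLE (ofWord [y] * T.right 1).isTableau
    rw [← left_rows_of_pos one_pos, ih] at h2
    exact h2
termination_by T.word.length

/-- Column insertion runs through the columns from left to right. Thus the first `b` columns do not
see the others, and the others receive only the letter, if any, that leaves the first `b`. -/
theorem letter_mul_cut (b : ℕ) (x : ℤ) (T : Tableau) :
    (ofWord [x] * T).left b = (ofWord [x] * T.left b).left b ∧
      (ofWord [x] * T).right b = (ofWord [x] * T.left b).right b * T.right b := by
  induction b generalizing x T with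
  | zero => simp
  | succ b ih =>
    obtain ⟨c, hc, hc'⟩ := exists_left_one_eq_column T
    have hc'' : (T.left (b + 1)).left 1 = column c hc := by rw [left_left (by omega), hc']
    obtain ⟨h1, h2⟩ := letter_mul x hc'
    obtain ⟨h3, h4⟩ := letter_mul x hc''
    rw [add_comm b 1, right_left] at h4
    have key : ∀ y : Option ℤ, (ofWord y.toList * T.right 1).left b =
        (ofWord y.toList * (T.right 1).left b).left b ∧ (ofWord y.toList * T.right 1).right b =
        (ofWord y.toList * (T.right 1).left b).right b * (T.right 1).right b := by
      rintro (_ | y)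
      · simp
      · exact ih y _
    obtain ⟨k1, k2⟩ := key (colInsert x c).2
    rw [add_comm b 1] at *
    constructor
    · apply eq_of_left_right 1
      · rw [left_left (by omega), left_left (by omega), h1, h3]
      · rw [right_left, right_left, h2, h4, k1]
    · rw [← right_right, ← right_right, ← right_right, h2, h4, k2]

theorem left_mul (b : ℕ) (A Q : Tableau) : (A * Q).left b = (A * Q.left b).left b ∧
    (A * Q).right b = (A * Q.left b).right b * Q.right b := by
  rw [← ofWord_rowWord A]
  induction rowWord A.rows with
  | nil => simp
  | cons x w ih =>
    rw [show x :: w = [x] ++ w from rfl, ofWord_append, mul_assoc, mul_assoc]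
    obtain ⟨h1, h2⟩ := letter_mul_cut b x (ofWord w * Q)
    obtain ⟨h3, h4⟩ := letter_mul_cut b x (ofWord w * Q.left b)
    exact ⟨by rw [h1, h3, ih.1], by rw [h2, h4, ih.2, ih.1, mul_assoc]⟩

/-! ### Products and cuts along rows -/

theorem _root_.insertWord_take_drop (a : ℕ) (T : List (List ℤ)) (w : List ℤ) (hT : IsTableau T) :
    (insertWord T w).take a = (insertWord (T.take a) w).take a ∧
      ∃ v, (insertWord T w).drop a = insertWord (T.drop a) v ∧
        (insertWord (T.take a) w).drop a = insertWord [] v := by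
  induction a generalizing T w with
  | zero => exact ⟨by simp, w, by simp, by simp⟩
  | succ a ih =>
    cases T with
    | nil =>
      have h : IsTableau ((insertWord [] w).drop (a + 1)) :=
        (isTableau_nil.insertWord w).of_sublist (List.drop_sublist _ _)
      -- With no rows left in `T`, both conclusions about `v` concern the same rows, and their own
      -- row word produces them.
      exact ⟨by simp, rowWord ((insertWord [] w).drop (a + 1)), by
        simp [insertWord_nil_rowWord h]⟩
    | cons r rs =>
      obtain ⟨h1, v, h2, h3⟩ := ih rs (rowInsertWord r w).2 (isTableau_cons.1 hT).2.2.2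
      refine ⟨?_, v, ?_, ?_⟩
      · simp [insertWord_rows_cons, h1]
      · simp [insertWord_rows_cons, h2]
      · simp [insertWord_rows_cons, h3]

theorem top_mul (a : ℕ) (P B : Tableau) : (P * B).top a = (P.top a * B).top a ∧
    (P * B).below a = P.below a * (P.top a * B).below a := by
  obtain ⟨h1, v, h2, h3⟩ := insertWord_take_drop a P.rows (rowWord B.rows) P.isTableau
  refine ⟨Tableau.ext h1, ?_⟩
  have : (P.top a * B).below a = ofWord v := Tableau.ext h3
  rw [this]
  ext1
  rw [mul_ofWord_rows]
  exact h2

end Tableau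

/-! ### Counting entries of the first row -/

/-- Let `x ≤ m`. If some entry lies in `(x, m]`, the bumped entry does too and the count stays the
same; otherwise the counts at `m` and at `x` agree and the count grows by one. The maximum covers
both cases. -/
theorem countP_rowInsert (x m : ℤ) {r : List ℤ} (hr : r.Pairwise (· ≤ ·)) :
    (rowInsert x r).1.countP (· ≤ m) =
      if x ≤ m then max (r.countP (· ≤ m)) (r.countP (· ≤ x) + 1) else r.countP (· ≤ m) := by
  induction r with
  | nil => by_cases h : x ≤ m <;> simp [rowInsert, h]
  | cons k r ih =>
    rw [List.pairwise_cons] at hr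
    have hz : ∀ n < k, r.countP (· ≤ n) = 0 := fun n hn => by
      rw [List.countP_eq_zero]
      intro y hy
      have := hr.1 y hy
      simp; omega
    by_cases hx : x < k
    · simp only [rowInsert, hx, if_true, List.countP_cons, hz x hx]
      by_cases hk : k ≤ m
      · simp [hk, hx.le.trans hk, not_le.2 hx]
      · simp [hk, hz m (by omega), not_le.2 hx]
    · have := ih hr.2
      simp only [rowInsert, hx, if_false, List.countP_cons, this]
      by_cases hm : x ≤ m
      · have h1 : k ≤ m := by omega
        have h2 : k ≤ x := by omega
        simp only [hm, h1, h2, if_true, decide_true]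
        omega
      · simp [hm]

/-- By the maximum formula the new count at `m` involves the old counts at `m` and at `x ≤ m`.
Monotonicity lets the allowance at `x` be absorbed in the one at `m`. -/
theorem countP_rowInsertWord (c : ℤ → ℕ) (hc : Monotone c) (w : List ℤ) {r s : List ℤ}
    (hr : r.Pairwise (· ≤ ·)) (hs : s.Pairwise (· ≤ ·))
    (h : ∀ m, s.countP (· ≤ m) ≤ r.countP (· ≤ m) ∧
      r.countP (· ≤ m) ≤ s.countP (· ≤ m) + c m) (m : ℤ) :
    (rowInsertWord s w).1.countP (· ≤ m) ≤ (rowInsertWord r w).1.countP (· ≤ m) ∧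
      (rowInsertWord r w).1.countP (· ≤ m) ≤ (rowInsertWord s w).1.countP (· ≤ m) + c m := by
  induction w generalizing r s with
  | nil => exact h m
  | cons x w ih =>
    refine ih (rowInsert_sorted x hr) (rowInsert_sorted x hs) fun n => ?_
    rw [countP_rowInsert x n hr, countP_rowInsert x n hs]
    have h1 := h n
    have h2 := h x
    split
    · rename_i hxn
      have := hc hxn
      omega
    · exact h1

/-- The first row of a list of rows. -/
def firstRow (T : List (List ℤ)) : List ℤ := T.headD []

theorem IsTableau.firstRow_sorted {T : List (List ℤ)} (h : IsTableau T) :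
    (firstRow T).Pairwise (· ≤ ·) := by
  cases T with
  | nil => simp [firstRow]
  | cons r T => exact (isTableau_cons.1 h).2.1

theorem firstRow_insertWord (T : List (List ℤ)) (w : List ℤ) :
    firstRow (insertWord T w) = (rowInsertWord (firstRow T) w).1 := by
  cases T with
  | nil =>
    cases w with
    | nil => rfl
    | cons x w => rw [insertWord_nil_rows (by simp)]; rfl
  | cons r T => rw [insertWord_rows_cons]; rfl

theorem mem_of_mem_firstRow {T : List (List ℤ)} {x : ℤ} (h : x ∈ firstRow T) : x ∈ rowWord T := by
  cases T with
  | nil => simp [firstRow] at h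
  | cons r T => exact mem_rowWord.2 ⟨r, by simp, h⟩

/-- The first rows of `V` and `U * V` arise by inserting the same word in the empty row and in the
first row of `U`. The initial difference of the counts is thus the count for `U`, and insertion
preserves this bound. -/
theorem Tableau.countP_firstRow_mul (U V : Tableau) (m : ℤ) :
    (firstRow V.rows).countP (· ≤ m) ≤ (firstRow (U * V).rows).countP (· ≤ m) ∧
      (firstRow (U * V).rows).countP (· ≤ m) ≤
        (firstRow V.rows).countP (· ≤ m) + (firstRow U.rows).countP (· ≤ m) := by
  have hV : firstRow V.rows = (rowInsertWord [] (rowWord V.rows)).1 := by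
    conv_lhs => rw [← insertWord_nil_rowWord V.isTableau, firstRow_insertWord]
    rfl
  rw [mul_rows, firstRow_insertWord, hV]
  refine countP_rowInsertWord (fun m => (firstRow U.rows).countP (· ≤ m)) ?_ _
    U.isTableau.firstRow_sorted (by simp) (by simp) m
  intro m n hmn
  refine List.countP_mono_left fun x _ hx => ?_
  simp only [decide_eq_true_eq] at hx ⊢
  omega

theorem ColLT.countP_le (m : ℤ) :
    ∀ {r s : List ℤ}, ColLT r s → s.countP (· ≤ m) ≤ r.countP (· < m)
  | _, [], _ => by simp
  | [], _ :: _, h => by simp [ColLT] at h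
  | x :: r, y :: s, h => by
    have := h.2.countP_le m
    have := h.1
    simp only [List.countP_cons, decide_eq_true_eq]
    split <;> split <;> omega

/-- The converse of `ColLT.countP_le` for increasing rows. It suffices to test at entries of `x`; in
`mul_rect_mul` only such `m` are known to exceed the entries of the rectangle. -/
theorem colLT_of_countP {p x : List ℤ} (hp : p.Pairwise (· ≤ ·)) (hx : x.Pairwise (· ≤ ·))
    (h : ∀ m ∈ x, x.countP (· ≤ m) ≤ p.countP (· < m)) : ColLT p x := by
  induction x generalizing p with
  | nil => simp [ColLT]
  | cons y s ih =>
    rw [List.pairwise_cons] at hx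
    have hy := h y (by simp)
    cases p with
    | nil => simp at hy
    | cons z r =>
      rw [List.pairwise_cons] at hp
      have hzy : z < y := by
        by_contra hcon
        have : (z :: r).countP (· < y) = 0 := by
          rw [List.countP_eq_zero]
          intro t ht
          rcases List.mem_cons.1 ht with rfl | ht
          · simpa using hcon
          · have := hp.1 t ht
            simp; omega
        simp [this] at hy
      refine ⟨hzy, ih hp.2 hx.2 fun m hm => ?_⟩
      have h1 := h m (by simp [hm])
      have h2 := hx.1 m hm
      simp only [List.countP_cons, decide_eq_true_eq, h2, if_true, hzy.trans_le h2] at h1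
      omega

/-! ### Tableaux on top of each other -/

theorem IsTableau.append {A X : List (List ℤ)} (hA : IsTableau A) (hX : IsTableau X)
    (h : ∀ p ∈ A, ColLT p (firstRow X)) : IsTableau (A ++ X) := by
  refine ⟨fun r hr => (List.mem_append.1 hr).elim (hA.ne_nil r) (hX.ne_nil r),
    fun r hr => (List.mem_append.1 hr).elim (hA.row_weak r) (hX.row_weak r),
    List.pairwise_append.2 ⟨hA.col_strict, hX.col_strict, fun p hp x hx => ?_⟩⟩
  cases X with
  | nil => simp at hx
  | cons y X =>
    rcases List.mem_cons.1 hx with rfl | hx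
    · exact h p hp
    · exact (h p hp).trans ((isTableau_cons.1 hX).2.2.1 x hx)

namespace Tableau

theorem mul_rows_of_isTableau_append {X A : Tableau} (h : IsTableau (A.rows ++ X.rows)) :
    (X * A).rows = A.rows ++ X.rows := by
  have e : ofWord (rowWord X.rows) * ofWord (rowWord A.rows) = ⟨A.rows ++ X.rows, h⟩ := by
    rw [← ofWord_append, ← rowWord_append]
    exact ofWord_rowWord ⟨A.rows ++ X.rows, h⟩
  rw [ofWord_rowWord, ofWord_rowWord] at e
  rw [e]

theorem colLT_firstRow_below {a : ℕ} {P : Tableau} {p : List ℤ} (hp : p ∈ P.rows.take a) :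
    ColLT p (firstRow (P.below a).rows) := by
  have h := P.isTableau.col_strict
  rw [← List.take_append_drop a P.rows, List.pairwise_append] at h
  rw [below_rows]
  cases hd : P.rows.drop a with
  | nil => cases p <;> simp [firstRow, ColLT]
  | cons q d => exact h.2.2 p hp q (by simp [hd])

/-- If the part of `P` below row `a` is a product `C * E`, then `E` fits below the first `a` rows
of `P`. -/
theorem below_right_factor {a : ℕ} {P C E : Tableau} (h : P.below a = C * E) :
    (E * P.top a).top a = P.top a ∧ (E * P.top a).below a = E := by
  by_cases hl : P.rows.length ≤ a
  · have h0 : C * E = ∅ := by rw [← h]; ext1; simpa [below_rows] using hl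
    rw [(mul_eq_empty h0).2]
    simp [top_top]
  · have hlen : (P.top a).rows.length = a := by simp [top_rows]; omega
    have ht : IsTableau ((P.top a).rows ++ E.rows) := by
      refine (P.top a).isTableau.append E.isTableau fun p hp => ?_
      refine colLT_of_countP ((P.top a).isTableau.row_weak p hp) E.isTableau.firstRow_sorted
        fun m _ => ?_
      -- The column condition holds for the first row of `C * E`; the right factor `E` has at most
      -- as many entries `≤ m` in its first row, so the condition passes to `E`.
      have h1 := (colLT_firstRow_below hp).countP_le m
      rw [h] at h1
      exact (countP_firstRow_mul C E m).1.trans h1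
    constructor
    · ext1; rw [top_rows, mul_rows_of_isTableau_append ht, List.take_left' hlen]
    · ext1; rw [below_rows, mul_rows_of_isTableau_append ht, List.drop_left' hlen]

/-! ### Products with a rectangle of small entries -/

theorem IsRect.length_eq {a b : ℕ} {T : Tableau} (h : T.IsRect a b) :
    ∀ r ∈ T.rows, r.length = b := by
  intro r hr
  obtain ⟨i, hi, rfl⟩ := List.getElem_of_mem hr
  have key : ∀ j, j < T.rows[i].length ↔ i < a ∧ j < b := fun j => by
    have := h i j
    simpa [entry, hi] using this
  have h0 : 0 < T.rows[i].length := List.length_pos_of_ne_nil (T.isTableau.ne_nil _ hr)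
  have ha := ((key 0).1 h0).1
  have h1 := key T.rows[i].length
  have h2 := key b
  omega

theorem IsRect.length_rows {a b : ℕ} {T : Tableau} (h : T.IsRect a b) (hb : 0 < b) :
    T.rows.length = a := by
  have key : ∀ i, i < T.rows.length ↔ i < a := fun i => by
    have := h i 0
    simp only [hb, and_true] at this
    rw [← this]
    constructor
    · intro hi
      have h0 := List.length_pos_of_ne_nil (T.isTableau.ne_nil _ (List.getElem_mem hi))
      simp [entry, hi, h0]
    · intro hs
      by_contra hi
      simp [entry, List.getElem?_eq_none (not_lt.1 hi)] at hs
  have h1 := key T.rows.length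
  have h2 := key a
  omega

theorem IsRect.eq_empty {a : ℕ} {T : Tableau} (h : T.IsRect a 0) : T = ∅ := by
  ext1
  rw [empty_rows, List.eq_nil_iff_forall_not_mem]
  intro r hr
  exact T.isTableau.ne_nil r hr (List.length_eq_zero_iff.1 (h.length_eq r hr))

theorem _root_.colLT_of_forall_lt : ∀ {r s : List ℤ}, s.length ≤ r.length →
    (∀ x ∈ r, ∀ y ∈ s, x < y) → ColLT r s
  | _, [], _, _ => by simp [ColLT]
  | [], _ :: _, h, _ => by simp at h
  | x :: r, y :: s, h, h' => ⟨h' x (by simp) y (by simp),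
      colLT_of_forall_lt (by simpa using h) fun u hu v hv => h' u (by simp [hu]) v (by simp [hv])⟩

/-- Inserting a row of length `b` that fits on top of the first `b` columns pushes these columns
down and leaves the other columns unchanged. -/
theorem _root_.insertWord_row_cut {b : ℕ} (hb : 0 < b) {rows : List (List ℤ)}
    (hrows : IsTableau rows) {x : List ℤ} (hx : x.Pairwise (· ≤ ·)) (hne : x ≠ [])
    (hlen : x.length = b ∨ x.length ≤ b ∧ ∀ r ∈ rows, r.length ≤ x.length)
    (h : ColLT x ((firstRow rows).take b)) :
    (insertWord rows x).map (List.take b) = x :: rows.map (List.take b) ∧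
      ((insertWord rows x).map (List.drop b)).filter (· ≠ []) =
        (rows.map (List.drop b)).filter (· ≠ []) := by
  have hxb : x.length ≤ b := by omega
  induction rows generalizing x with
  | nil =>
    rw [insertWord_row_nil hx hne]
    simp [List.take_of_length_le hxb, List.drop_of_length_le hxb]
  | cons q rows ih =>
    obtain ⟨h1, h2, h3, h4⟩ := isTableau_cons.1 hrows
    have htake : q.take x.length = q.take b := by
      rcases hlen with hl | hl
      · rw [hl]
      · have := hl.2 q (by simp)
        rw [List.take_of_length_le this, List.take_of_length_le (this.trans hxb)]
    have hdrop : q.drop x.length = q.drop b := by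
      rcases hlen with hl | hl
      · rw [hl]
      · have := hl.2 q (by simp)
        rw [List.drop_of_length_le this, List.drop_of_length_le (this.trans hxb)]
    have hcut : (x ++ q.drop b).take b = x ∧ (x ++ q.drop b).drop b = q.drop b := by
      rcases hlen with hl | hl
      · exact ⟨List.take_left' hl, List.drop_left' hl⟩
      · have := hl.2 q (by simp)
        rw [List.drop_of_length_le (this.trans hxb), List.append_nil]
        exact ⟨List.take_of_length_le hxb, List.drop_of_length_le hxb⟩
    have h' : ColLT x (q.take b) := h
    rw [insertWord_rows_cons, rowInsertWord_of_colLT hx (by rwa [htake]), htake, hdrop]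
    -- The bumped word is the start of `q`. It has length `b` unless `q` is shorter, and then all
    -- lower rows are at most as long as `q`, which is the second alternative of `hlen`.
    obtain ⟨i1, i2⟩ := ih h4 (x := q.take b) (h2.sublist (List.take_sublist _ _))
      (by simp [h1]; omega) (by
        by_cases hq : b ≤ q.length
        · left; simpa using hq
        · right
          refine ⟨by simp, fun r hr => ?_⟩
          have := (h3 r hr).length_le
          simp; omega) (by
        cases rows with
        | nil => cases q.take b <;> simp [firstRow, ColLT]
        | cons s rows => exact (h3 s (by simp)).take b) (by simp)
    constructor
    · rw [List.map_cons, i1, hcut.1, List.map_cons]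
    · rw [List.map_cons, hcut.2, List.map_cons, List.filter_cons, List.filter_cons, i2]

theorem mul_rect_cut {b : ℕ} (hb : 0 < b) (Q : Tableau) {rows : List (List ℤ)}
    (hT : IsTableau rows) (hlen : ∀ r ∈ rows, r.length = b)
    (h : ∀ r ∈ rows, ∀ x ∈ r, ∀ y ∈ Q.word, x < y) :
    ((Q * ⟨rows, hT⟩).left b).rows = rows ++ (Q.left b).rows ∧
      (Q * ⟨rows, hT⟩).right b = Q.right b := by
  induction rows with
  | nil => exact ⟨rfl, rfl⟩
  | cons t rows ih =>
    obtain ⟨h1, h2, h3, h4⟩ := isTableau_cons.1 hT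
    obtain ⟨i1, i2⟩ := ih h4 (fun r hr => hlen r (by simp [hr])) fun r hr => h r (by simp [hr])
    have hmul : (Q * ⟨t :: rows, hT⟩).rows = insertWord (Q * ⟨rows, h4⟩).rows t := by
      rw [mul_rows, rowWord_cons, insertWord_append]; rfl
    have ht : t.length = b := hlen t (by simp)
    -- The rectangle is inserted from its bottom row upwards. What `t` meets in the first `b`
    -- columns is the next row of the rectangle or, for the bottom row, the first row of `Q.left b`,
    -- whose entries are larger.
    have hcol : ColLT t ((firstRow (Q * ⟨rows, h4⟩).rows).take b) := by
      have e : (firstRow (Q * ⟨rows, h4⟩).rows).take b =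
          firstRow (rows ++ (Q.left b).rows) := by
        rw [← i1, left_rows_of_pos hb]
        cases (Q * ⟨rows, h4⟩).rows <;> simp [firstRow]
      rw [e]
      cases rows with
      | nil =>
        refine colLT_of_forall_lt ?_ fun x hx y hy =>
          h t (by simp) x hx y (mem_left (b := b) (mem_of_mem_firstRow hy))
        rw [List.nil_append, left_rows_of_pos hb]
        cases Q.rows <;> simp [firstRow, ht]
      | cons s rows => exact h3 s (by simp)
    obtain ⟨j1, j2⟩ := insertWord_row_cut hb (Q * ⟨rows, h4⟩).isTableau h2 h1 (.inl ht) hcol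
    constructor
    · rw [left_rows_of_pos hb, hmul, j1, ← left_rows_of_pos hb, i1]; rfl
    · ext1
      rw [right_rows, hmul, j2, ← right_rows, i2]

/-- The columns of `Q` to the right of column `b` can be moved across a rectangle with `b` columns
and smaller entries. -/
theorem mul_rect {a b : ℕ} {Q T : Tableau} (hT : T.IsRect a b)
    (h : ∀ x ∈ T.word, ∀ y ∈ Q.word, x < y) : Q * T = Q.left b * T * Q.right b := by
  rcases Nat.eq_zero_or_pos b with rfl | hb
  · simp [hT.eq_empty]
  · have hlt : ∀ r ∈ T.rows, ∀ x ∈ r, ∀ y ∈ Q.word, x < y :=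
      fun r hr x hx => h x (mem_rowWord.2 ⟨r, hr, hx⟩)
    obtain ⟨h1, h2⟩ := mul_rect_cut hb Q T.isTableau hT.length_eq hlt
    have h3 := mul_rows_of_isTableau_append (X := Q.left b) (A := T)
      (by rw [← h1]; exact Tableau.isTableau _)
    have h4 : (Q * T).left b = Q.left b * T := Tableau.ext (h1.trans h3.symm)
    rw [← h4, ← h2]
    exact (left_mul_right b _).symm

theorem _root_.glueRows_take_drop : ∀ {T P : List (List ℤ)},
    glueRows T P = glueRows T (P.take T.length) ++ P.drop T.length
  | [], P => by simp
  | _ :: _, [] => by simp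
  | t :: T, p :: P => by
    simp [glueRows, glueRows_take_drop (T := T) (P := P)]

theorem _root_.glueRows_length : ∀ {T P : List (List ℤ)}, P.length ≤ T.length →
    (glueRows T P).length = T.length
  | [], P, h => by simpa using h
  | _ :: _, [], _ => by simp
  | t :: T, p :: P, h => by
    simp [glueRows, glueRows_length (T := T) (P := P) (by simpa using h)]

theorem _root_.mem_glueRows : ∀ {T P : List (List ℤ)}, P.length ≤ T.length →
    ∀ {q : List ℤ}, q ∈ glueRows T P →
      ∃ t ∈ T, ∃ p, q = t ++ p ∧ (p ∈ P ∨ p = [] ∧ P.length < T.length)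
  | [], P, h, q, hq => by
    have : P = [] := by simpa using h
    simp [this] at hq
  | t :: T, [], _, q, hq => ⟨q, by simpa using hq, [], by simp⟩
  | t :: T, p :: P, h, q, hq => by
    rcases List.mem_cons.1 hq with rfl | hq
    · exact ⟨t, by simp, p, rfl, by simp⟩
    · obtain ⟨t', ht', p', rfl, hp'⟩ := mem_glueRows (T := T) (P := P) (by simpa using h) hq
      refine ⟨t', by simp [ht'], p', rfl, ?_⟩
      simpa using hp'.imp .inr id

theorem _root_.beside_of_forall_le {b : ℕ} : ∀ {L R : List (List ℤ)}, R.length ≤ L.length →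
    (∀ l ∈ L, l.length = b) → (∀ l ∈ L, ∀ r ∈ R, ∀ x ∈ l, ∀ y ∈ r, x ≤ y) → Beside b L R
  | _, [], _, h, _ => beside_nil_right.2 fun l hl => (h l hl).le
  | [], _ :: _, h, _, _ => by simp at h
  | l :: L, r :: R, h, h', h'' => ⟨h' l (by simp), h'' l (by simp) r (by simp),
      beside_of_forall_le (by simpa using h) (fun k hk => h' k (by simp [hk]))
        fun k hk s hs => h'' k (by simp [hk]) s (by simp [hs])⟩

theorem _root_.rowLE_of_forall_le : ∀ {L R : List (List ℤ)},
    (∀ l ∈ L, ∀ r ∈ R, ∀ x ∈ l, ∀ y ∈ r, x ≤ y) → RowLE L R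
  | _, [], _ => by simp
  | [], _ :: _, _ => by simp
  | l :: L, r :: R, h => ⟨h l (by simp) r (by simp),
      rowLE_of_forall_le fun k hk s hs => h k (by simp [hk]) s (by simp [hs])⟩

/-- The parts of a product `Q * T * P`, where `T` is a rectangle with entries smaller than those of
`Q` and `P` and `Q` has no more columns than `T`. -/
theorem mul_rect_mul {a b : ℕ} {Q T P : Tableau} (hT : T.IsRect a b)
    (hQ : ∀ x ∈ T.word, ∀ y ∈ Q.word, x < y) (hP : ∀ x ∈ T.word, ∀ y ∈ P.word, x < y)
    (hb : Q.right b = ∅) :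
    (Q * T * P).below a = Q * P.below a ∧ ((Q * T * P).top a).left b = T ∧
      ((Q * T * P).top a).right b = P.top a := by
  rcases Nat.eq_zero_or_pos b with rfl | hb0
  · simp only [right_zero] at hb
    simp [hb, hT.eq_empty]
  have ha := hT.length_rows hb0
  have hle : ∀ l ∈ T.rows, ∀ r ∈ P.rows, ∀ x ∈ l, ∀ y ∈ r, x ≤ y := fun l hl r hr x hx y hy =>
    (hP x (mem_rowWord.2 ⟨l, hl, hx⟩) y (mem_rowWord.2 ⟨r, hr, hy⟩)).le
  have hbes : Beside b T.rows (P.top a).rows :=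
    beside_of_forall_le (by rw [top_rows, ha]; simp) hT.length_eq
      fun l hl r hr => hle l hl r (List.mem_of_mem_take hr)
  -- Since the entries of `T` are smaller, the rows of `P` are glued to the right of its `a` rows,
  -- and later rows of `P` remain as they are below them.
  have hTP : T * P = P.below a * (T * P.top a) := by
    have e : (T * P).rows = (T * P.top a).rows ++ (P.below a).rows := by
      rw [mul_rows_of_beside hbes, mul_rows, insertWord_rowWord P.isTableau (rowLE_of_forall_le hle),
        glueRows_take_drop, ha]
      rfl
    ext1
    rw [e, mul_rows_of_isTableau_append (X := P.below a) (by rw [← e]; exact Tableau.isTableau _)]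
  have hlen : (T * P.top a).rows.length = a := by
    rw [mul_rows_of_beside hbes, glueRows_length (by rw [top_rows, ha]; simp), ha]
  have hQrow : ∀ m, (firstRow Q.rows).countP (· ≤ m) ≤ b := by
    intro m
    refine List.countP_le_length.trans ?_
    by_contra hcon
    cases hq : Q.rows with
    | nil => simp [hq, firstRow] at hcon
    | cons q qs =>
      have : q.drop b ∈ (Q.right b).rows := by
        rw [right_rows, hq]
        refine List.mem_filter.2 ⟨by simp, ?_⟩
        simpa [hq, firstRow] using hcon
      simp [hb] at this
  -- Columns are compared by counting. The first row of `Q * P.below a` has at most `b` entries `≤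
  -- m` on account of `Q`, matched by the `b` entries of a row of `T`; those on account of `P.below
  -- a` are matched by the row of `P.top a` next to it.
  have ht : IsTableau ((T * P.top a).rows ++ (Q * P.below a).rows) := by
    refine (Tableau.isTableau _).append (Tableau.isTableau _) fun p hp => ?_
    refine colLT_of_countP ((Tableau.isTableau _).row_weak p hp)
      (Tableau.isTableau _).firstRow_sorted fun m hm => ?_
    rw [mul_rows_of_beside hbes] at hp
    obtain ⟨t, htT, q, rfl, hq⟩ := mem_glueRows (by rw [top_rows, ha]; simp) hp
    have hmem : m ∈ Q.word ∨ m ∈ P.word :=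
      (mem_mul_word.1 (mem_of_mem_firstRow hm)).imp id mem_below
    have htm : t.countP (· < m) = b := by
      rw [← hT.length_eq t htT, List.countP_eq_length]
      intro x hx
      have hxT : x ∈ T.word := mem_rowWord.2 ⟨t, htT, hx⟩
      simpa using hmem.elim (hQ x hxT m) (hP x hxT m)
    have hqm : (firstRow (P.below a).rows).countP (· ≤ m) ≤ q.countP (· < m) := by
      rcases hq with hq | ⟨rfl, hq⟩
      · exact (colLT_firstRow_below hq).countP_le m
      · have : (P.below a).rows = [] := by
          rw [below_rows, List.drop_eq_nil_iff]
          simp only [top_rows, List.length_take, ha] at hq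
          omega
        simp [this, firstRow]
    rw [List.countP_append, htm]
    have := (countP_firstRow_mul Q (P.below a) m).2
    have := hQrow m
    omega
  have hW : Q * T * P = (Q * P.below a) * (T * P.top a) := by
    rw [mul_assoc, hTP, mul_assoc]
  have htop : (Q * T * P).top a = T * P.top a := by
    ext1; rw [hW, top_rows, mul_rows_of_isTableau_append ht, List.take_left' hlen]
  refine ⟨?_, ?_, ?_⟩
  · ext1; rw [hW, below_rows, mul_rows_of_isTableau_append ht, List.drop_left' hlen]
  · rw [htop, left_mul_of_beside hbes]
  · rw [htop, right_mul_of_beside hbes]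

end Tableau

/-! ### Simple factorizations -/

namespace Tableau

/-- The extreme choice with all of Z in the right factor, which thereby becomes everything after
column `b`. A right factor of that part can then be handed to the next tableau. -/
theorem isSimpleFactorization_right {a b : ℕ} {W T : Tableau} (h : (W.top a).left b = T) :
    IsSimpleFactorization a b W ((W.below a).left b) T (W.right b) := by
  refine ⟨h.symm, ?_, ∅, (W.below a).right b, by simp, by simp, ?_⟩
  · rw [← h, left_below, left_top, below_mul_top, left_mul_right]
  · rw [right_below, right_top, below_mul_top]

/-- The opposite extreme, with all of Z in the left factor, for transfers to the previous tableau.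
-/
theorem isSimpleFactorization_below {a b : ℕ} {W T : Tableau} (h : (W.top a).left b = T) :
    IsSimpleFactorization a b W (W.below a) T ((W.top a).right b) := by
  refine ⟨h.symm, ?_, (W.below a).right b, ∅, by simp, by simp, by simp⟩
  rw [← h, mul_assoc, left_mul_right, below_mul_top]

/-- Splitting off a right factor of the part of `Q` to the right of column `b` from `A * Q` does
not change the first columns. -/
theorem cut_mul_left_factor {b c : ℕ} (hbc : c ≤ b) {A Q C E : Tableau} (h : Q.right b = C * E) :
    (A * (Q.left b * C)).left c = (A * Q).left c ∧
      (A * Q).right c = (A * (Q.left b * C)).right c * E := by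
  obtain ⟨h1, h2⟩ := beside_left_factor h
  obtain ⟨h3, h4⟩ := left_mul b A Q
  obtain ⟨h5, h6⟩ := left_mul b A (Q.left b * C)
  rw [h1] at h5 h6
  rw [h2] at h6
  have hl : (A * (Q.left b * C)).left b = (A * Q).left b := h5.trans h3.symm
  have hr : (A * Q).right b = (A * (Q.left b * C)).right b * E := by
    rw [h4, h6, h, mul_assoc]
  refine ⟨by rw [← left_left hbc, hl, left_left hbc], ?_⟩
  rw [right_of_le hbc, hr, ← hl, ← mul_assoc, ← right_of_le hbc]

/-- Splitting off a left factor of the part of `P` below row `a` from `P * B` does not change the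
first rows. -/
theorem cut_right_factor_mul {a c : ℕ} (hac : c ≤ a) {P B C E : Tableau} (h : P.below a = C * E) :
    (E * P.top a * B).top c = (P * B).top c ∧
      (P * B).below c = C * (E * P.top a * B).below c := by
  obtain ⟨h1, h2⟩ := below_right_factor h
  obtain ⟨h3, h4⟩ := top_mul a P B
  obtain ⟨h5, h6⟩ := top_mul a (E * P.top a) B
  rw [h1] at h5 h6
  rw [h2] at h6
  have hl : (E * P.top a * B).top a = (P * B).top a := h5.trans h3.symm
  have hr : (P * B).below a = C * (E * P.top a * B).below a := by
    rw [h4, h6, h, mul_assoc]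
  refine ⟨by rw [← top_top hac, hl, top_top hac], ?_⟩
  rw [below_of_le hac, hr, ← hl, mul_assoc, ← below_of_le hac]

end Tableau

/-! ### Factor sequences -/

/-- The inequality `occur` compares a rectangle with its neighbours in the row above: it is no wider
than the right one and, by the next lemma, no taller than the left one. Cuts at the edge of the
neighbour therefore refine to cuts at its own edge. -/
theorem RankConditions.numCols_bottom_le {n : ℕ} (r : RankConditions (n + 1)) {i : ℕ} (hi : i < n) :
    r.bottom.numCols i (i + 1) ≤ r.numCols (i + 1) (i + 1 + 1) := by
  have := r.occur i (i + 1 + 1) le_rfl (by omega)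
  simp only [RankConditions.numCols, RankConditions.bottom, Nat.add_sub_cancel] at this ⊢
  omega

theorem RankConditions.numRows_bottom_le {n : ℕ} (r : RankConditions (n + 1)) {i : ℕ} (hi : i < n) :
    r.bottom.numRows i (i + 1) ≤ r.numRows i (i + 1) := by
  have := r.occur i (i + 1 + 1) le_rfl (by omega)
  simp only [RankConditions.numRows, RankConditions.bottom, Nat.add_sub_cancel] at this ⊢
  omega

/-- The first tableau of `Q` and the last tableau of `P` are empty, and the products of the
other tableaux form a factor sequence for the bottom rows of the diagram. -/
def IsFactorPair {m : ℕ} {r : RankConditions (m + 1)} (D : TableauDiagram r)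
    (Q P : Fin (m + 1) → Tableau) : Prop :=
  Q 0 = ∅ ∧ P (Fin.last m) = ∅ ∧
    IsFactorSequence D.bottom (fun i : Fin m => P i.castSucc * Q i.succ)

/-- Adding an empty first `Q` and an empty last `P` gives all tableaux of the sequence the same
form. The diagram with one row is included through the convention on the empty sequence. -/
theorem isFactorSequence_iff {m : ℕ} {r : RankConditions (m + 1)} (D : TableauDiagram r)
    (W : Fin (m + 1) → Tableau) :
    IsFactorSequence D W ↔ ∃ Q P : Fin (m + 1) → Tableau,
      (∀ i, W i = Q i * D.T i (i + 1) * P i) ∧ IsFactorPair D Q P := by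
  cases m with
  | zero =>
    constructor
    · intro h
      refine ⟨fun _ => ∅, fun _ => ∅, fun i => ?_, rfl, rfl, trivial⟩
      obtain rfl : i = 0 := Fin.fin_one_eq_zero i
      simpa using (show W 0 = D.T 0 1 from h)
    · rintro ⟨Q, P, h, hQ, hP, _⟩
      have h0 := h 0
      rw [hQ, show P 0 = ∅ from hP] at h0
      show W 0 = D.T 0 1
      simpa using h0
  | succ m =>
    constructor
    · rintro ⟨U, P, Q, hU, hPQ, h1, h2, h3⟩
      refine ⟨Fin.cons ∅ Q, Fin.snoc P ∅, fun i => ?_, by simp, by simp, ?_⟩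
      · refine Fin.cases ?_ (fun k => ?_) i
        · have h0 : (Fin.snoc P ∅ : Fin (m + 2) → Tableau) 0 = P 0 :=
            Fin.snoc_castSucc (α := fun _ => Tableau) ∅ P 0
          rw [h1, h0, Fin.cons_zero]
          simp
        · refine Fin.lastCases ?_ (fun j => ?_) k
          · rw [Fin.succ_last, h3, Fin.snoc_last, ← Fin.succ_last, Fin.cons_succ]
            simp
          · rw [Fin.cons_succ, Fin.succ_castSucc, h2, Fin.snoc_castSucc]
            simp
      · have : U = fun i => (Fin.snoc P ∅ : Fin (m + 2) → Tableau) i.castSucc *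
            (Fin.cons ∅ Q : Fin (m + 2) → Tableau) i.succ := by
          funext i
          rw [hPQ, Fin.snoc_castSucc, Fin.cons_succ]
        rwa [this] at hU
    · rintro ⟨Q, P, h, hQ, hP, hU⟩
      refine ⟨_, fun i => P i.castSucc, fun i => Q i.succ, hU, fun i => rfl, ?_, fun i => ?_, ?_⟩
      · simpa [hQ] using h 0
      · have := h i.succ.castSucc
        simpa using this
      · have := h (Fin.last (m + 1))
        simpa [hP] using this

/-- Each letter at position `i` comes from a tableau whose index interval contains `[i, i+1]`. For
the bottom diagram these intervals become strictly larger, so the entries of each `Q i` and `P i`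
exceed those of `T i (i+1)`. -/
theorem IsFactorSequence.mem_word {n : ℕ} {r : RankConditions n} {D : TableauDiagram r}
    {W : Fin n → Tableau} (h : IsFactorSequence D W) (i : Fin n) {x : ℤ} (hx : x ∈ (W i).word) :
    ∃ k l, k ≤ (i : ℕ) ∧ (i : ℕ) < l ∧ l ≤ n ∧ x ∈ (D.T k l).word := by
  induction n with
  | zero => exact i.elim0
  | succ m ih =>
    obtain ⟨Q, P, hW, hQ, hP, hU⟩ := (isFactorSequence_iff D W).1 h
    rw [hW, Tableau.mem_mul_word, Tableau.mem_mul_word] at hx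
    rcases hx with (hx | hx) | hx
    · induction i using Fin.cases with
      | zero => rw [hQ] at hx; simp [Tableau.word] at hx
      | succ j =>
        obtain ⟨k, l, h1, h2, h3, h4⟩ := ih hU j (Tableau.mem_mul_word.2 (.inr hx))
        refine ⟨k, l + 1, ?_, ?_, by omega, h4⟩ <;> simp only [Fin.val_succ] <;> omega
    · exact ⟨i, i + 1, le_rfl, by omega, by omega, hx⟩
    · induction i using Fin.lastCases with
      | last => rw [hP] at hx; simp [Tableau.word] at hx
      | cast j =>
        obtain ⟨k, l, h1, h2, h3, h4⟩ := ih hU j (Tableau.mem_mul_word.2 (.inl hx))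
        refine ⟨k, l + 1, ?_, ?_, by omega, h4⟩ <;> simp only [Fin.val_castSucc] <;> omega

/-! ### The rectangles inside the tableaux of a factor sequence -/

namespace IsFactorPair

variable {m : ℕ} {r : RankConditions (m + 1)} {D : TableauDiagram r} {Q P : Fin (m + 1) → Tableau}

theorem lt_left (h : IsFactorPair D Q P) (i : Fin (m + 1)) :
    ∀ x ∈ (D.T i (i + 1)).word, ∀ y ∈ (Q i).word, x < y := by
  intro x hx y hy
  induction i using Fin.cases with
  | zero => rw [h.1] at hy; simp [Tableau.word] at hy
  | succ j =>
    obtain ⟨k, l, h1, h2, h3, h4⟩ := h.2.2.mem_word j (Tableau.mem_mul_word.2 (.inr hy))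
    have hj : ((j.succ : Fin (m + 1)) : ℕ) = j + 1 := by simp
    rw [hj] at hx
    exact D.lt k (l + 1) _ _ (by omega) (by omega) (by omega) (by omega)
      (by simp; omega) x hx y h4

theorem lt_right (h : IsFactorPair D Q P) (i : Fin (m + 1)) :
    ∀ x ∈ (D.T i (i + 1)).word, ∀ y ∈ (P i).word, x < y := by
  intro x hx y hy
  induction i using Fin.lastCases with
  | last => rw [h.2.1] at hy; simp [Tableau.word] at hy
  | cast j =>
    obtain ⟨k, l, h1, h2, h3, h4⟩ := h.2.2.mem_word j (Tableau.mem_mul_word.2 (.inl hy))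
    have hj : ((j.castSucc : Fin (m + 1)) : ℕ) = j := by simp
    rw [hj] at hx
    exact D.lt k (l + 1) _ _ (by omega) (by omega) (by omega) (by omega)
      (by simp; omega) x hx y h4

theorem rect_cut (h : IsFactorPair D Q P) (i : Fin (m + 1)) {W q p : Tableau}
    (hW : W = Q i * D.T i (i + 1) * P i) (hq : q = (Q i).left (r.numCols i (i + 1)))
    (hp : p = (Q i).right (r.numCols i (i + 1)) * P i) :
    W.below (r.numRows i (i + 1)) = q * p.below (r.numRows i (i + 1)) ∧
      (W.top (r.numRows i (i + 1))).left (r.numCols i (i + 1)) = D.T i (i + 1) ∧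
      (W.top (r.numRows i (i + 1))).right (r.numCols i (i + 1)) = p.top (r.numRows i (i + 1)) := by
  have hrect := D.isRect i (i + 1) (by omega) (by omega)
  have hW' : W = q * D.T i (i + 1) * p := by
    rw [hW, Tableau.mul_rect hrect (h.lt_left i), mul_assoc, hq, hp]
  rw [hW']
  refine Tableau.mul_rect_mul hrect (fun x hx y hy => ?_) (fun x hx y hy => ?_) (by simp [hq])
  · rw [hq] at hy
    exact h.lt_left i x hx y (Tableau.mem_left hy)
  · rw [hp] at hy
    rcases Tableau.mem_mul_word.1 hy with hy | hy
    · exact h.lt_left i x hx y (Tableau.mem_right hy)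
    · exact h.lt_right i x hx y hy

end IsFactorPair

/-- This provides the two extreme simple factorizations for every tableau of a factor sequence. -/
theorem IsFactorSequence.top_left {m : ℕ} {r : RankConditions (m + 1)} {D : TableauDiagram r}
    {W : Fin (m + 1) → Tableau} (h : IsFactorSequence D W) (i : Fin (m + 1)) :
    ((W i).top (r.numRows i (i + 1))).left (r.numCols i (i + 1)) = D.T i (i + 1) := by
  obtain ⟨Q, P, hW, hQP⟩ := (isFactorSequence_iff D W).1 h
  exact (hQP.rect_cut i (hW i) rfl rfl).2.1

/-- Each choice of simple factorizations of the tableaux of a factor sequence gives a factor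
sequence for the bottom rows. -/
def SimpleFactorizationsFactor {m : ℕ} {r : RankConditions (m + 1)} (D : TableauDiagram r) : Prop :=
  ∀ W Q P : Fin (m + 1) → Tableau,
    (∀ i : Fin (m + 1), Tableau.IsSimpleFactorization
      (r.numRows i (i + 1)) (r.numCols i (i + 1)) (W i) (Q i) (D.T i (i + 1)) (P i)) →
    IsFactorSequence D W → IsFactorPair D Q P

/-- A right factor of the last part of a tableau of a factor sequence can be moved to the next
tableau of the sequence. -/
theorem IsFactorSequence.move_right {m : ℕ} {r : RankConditions (m + 1)} {D : TableauDiagram r}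
    (H : SimpleFactorizationsFactor D) {U : Fin (m + 1) → Tableau} (hU : IsFactorSequence D U)
    (j : Fin (m + 1)) {V E : Tableau}
    (hl : V.left (r.numCols j (j + 1)) = (U j).left (r.numCols j (j + 1)))
    (hr : (U j).right (r.numCols j (j + 1)) = V.right (r.numCols j (j + 1)) * E) :
    (j = Fin.last m → E = ∅) ∧ IsFactorSequence D
      (fun k => if k = j then V else if k.castSucc = j.succ then E * U k else U k) := by
  have hT := hU.top_left
  set q : Fin (m + 1) → Tableau := fun k =>
    ((U k).below (r.numRows k (k + 1))).left (r.numCols k (k + 1)) with hq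
  set p : Fin (m + 1) → Tableau := fun k => (U k).right (r.numCols k (k + 1)) with hp
  have hs := fun k => Tableau.isSimpleFactorization_right (hT k)
  -- With all of Z on the right, `p j` is the whole part of `U j` after the rectangle's columns, and
  -- `E` is a right factor of it.
  obtain ⟨h1, h2, h3⟩ := H U q p hs hU
  have hV : V = q j * D.T j (j + 1) * V.right (r.numCols j (j + 1)) := by
    rw [hq, ← hT j]
    simp only [Tableau.left_below, Tableau.left_top, ← hl, Tableau.below_mul_top,
      Tableau.left_mul_right]
  have hlast : j = Fin.last m → V.right (r.numCols j (j + 1)) = ∅ ∧ E = ∅ := by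
    rintro rfl
    exact Tableau.mul_eq_empty (hr.symm.trans h2)
  refine ⟨fun h => (hlast h).2, (isFactorSequence_iff _ _).2
    ⟨fun k => if k.castSucc = j.succ then E * q k else q k,
      fun k => if k = j then V.right (r.numCols j (j + 1)) else p k, fun k => ?_, ?_, ?_, ?_⟩⟩
  · have hUk : U k = q k * D.T k (k + 1) * p k := (hs k).2.1
    by_cases hk : k = j
    · subst hk
      have : k.castSucc ≠ k.succ := Fin.castSucc_lt_succ.ne
      simp only [if_true, this, if_false]
      exact hV
    · simp only [hk, if_false]
      split
      · rw [hUk]; simp only [mul_assoc]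
      · exact hUk
  · have : (0 : Fin (m + 1)).castSucc ≠ j.succ := (Fin.succ_ne_zero j).symm
    simp only [this, if_false]
    exact h1
  · by_cases hj : Fin.last m = j
    · simp only [hj, if_true]
      exact (hlast hj.symm).1
    · simp only [hj, if_false]
      exact h2
  -- Moving `E` from the end of `p j` to the start of the next `q` only regroups their product, so
  -- the sequence one level down is the same.
  · convert h3 using 2 with k
    simp only [← Fin.succ_castSucc, Fin.succ_inj]
    by_cases hk : k.castSucc = j
    · simp only [hk, if_true]
      rw [← mul_assoc]
      congr 1
      rw [← hr]
    · simp only [hk, if_false]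

/-- A left factor of the first part of a tableau of a factor sequence can be moved to the previous
tableau of the sequence. -/
theorem IsFactorSequence.move_left {m : ℕ} {r : RankConditions (m + 1)} {D : TableauDiagram r}
    (H : SimpleFactorizationsFactor D) {U : Fin (m + 1) → Tableau} (hU : IsFactorSequence D U)
    (j : Fin (m + 1)) {V C : Tableau}
    (hl : V.top (r.numRows j (j + 1)) = (U j).top (r.numRows j (j + 1)))
    (hr : (U j).below (r.numRows j (j + 1)) = C * V.below (r.numRows j (j + 1))) :
    (j = 0 → C = ∅) ∧ IsFactorSequence D
      (fun k => if k = j then V else if k.succ = j.castSucc then U k * C else U k) := by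
  have hT := hU.top_left
  set q : Fin (m + 1) → Tableau := fun k => (U k).below (r.numRows k (k + 1)) with hq
  set p : Fin (m + 1) → Tableau := fun k =>
    ((U k).top (r.numRows k (k + 1))).right (r.numCols k (k + 1)) with hp
  have hs := fun k => Tableau.isSimpleFactorization_below (hT k)
  -- With all of Z on the left, `q j` is the whole part of `U j` below the rectangle's rows, and `C`
  -- is a left factor of it.
  obtain ⟨h1, h2, h3⟩ := H U q p hs hU
  have hV : V = V.below (r.numRows j (j + 1)) * D.T j (j + 1) * p j := by
    rw [hp, ← hT j, ← hl, mul_assoc]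
    simp only [← hl, Tableau.left_mul_right, Tableau.below_mul_top]
  have hlast : j = 0 → C = ∅ ∧ V.below (r.numRows j (j + 1)) = ∅ := by
    rintro rfl
    exact Tableau.mul_eq_empty (hr.symm.trans h1)
  refine ⟨fun h => (hlast h).1, (isFactorSequence_iff _ _).2
    ⟨fun k => if k = j then V.below (r.numRows j (j + 1)) else q k,
      fun k => if k.succ = j.castSucc then p k * C else p k, fun k => ?_, ?_, ?_, ?_⟩⟩
  · have hUk : U k = q k * D.T k (k + 1) * p k := (hs k).2.1
    by_cases hk : k = j
    · subst hk
      have : k.succ ≠ k.castSucc := Fin.castSucc_lt_succ.ne'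
      simp only [if_true, this, if_false]
      exact hV
    · simp only [hk, if_false]
      split
      · rw [hUk]; simp only [mul_assoc]
      · exact hUk
  · by_cases hj : 0 = j
    · simp only [hj, if_true]
      exact (hlast hj.symm).2
    · simp only [hj, if_false]
      exact h1
  · have : (Fin.last m).succ ≠ j.castSucc := by
      rw [Fin.succ_last]; exact (Fin.castSucc_lt_last j).ne'
    simp only [this, if_false]
    exact h2
  · convert h3 using 2 with k
    simp only [Fin.succ_castSucc, Fin.castSucc_inj]
    by_cases hk : k.succ = j
    · simp only [hk, if_true]
      rw [mul_assoc]
      congr 1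
      rw [← hr]
    · simp only [hk, if_false]

/-! ### Transfers between the two factors at one index -/

namespace IsFactorPair

variable {m : ℕ} {r : RankConditions (m + 1 + 1)} {D : TableauDiagram r}
  {Q P : Fin (m + 1 + 1) → Tableau}

/-- In the bottom sequence the product ending in `Q i` loses `E` and the next one gains it on the
left. The loss is visible after the columns of the lower rectangle, as that one is no wider, so
`IsFactorSequence.move_right` applies. -/
theorem move_right (H : SimpleFactorizationsFactor D.bottom) (h : IsFactorPair D Q P)
    (i : Fin (m + 1 + 1)) {C E : Tableau} (hCE : (Q i).right (r.numCols i (i + 1)) = C * E) :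
    IsFactorPair D (Function.update Q i ((Q i).left (r.numCols i (i + 1)) * C))
      (Function.update P i (E * P i)) := by
  obtain ⟨h1, h2, h3⟩ := h
  induction i using Fin.cases with
  | zero =>
    rw [h1, Tableau.right_empty] at hCE
    obtain ⟨rfl, rfl⟩ := Tableau.mul_eq_empty hCE.symm
    rw [h1, Tableau.left_empty, Tableau.mul_empty, Tableau.empty_mul, ← h1,
      Function.update_eq_self, Function.update_eq_self]
    exact ⟨h1, h2, h3⟩
  | succ j =>
    rw [Fin.val_succ] at hCE ⊢
    obtain ⟨k1, k2⟩ := Tableau.cut_mul_left_factor (r.numCols_bottom_le j.isLt)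
      (A := P j.castSucc) hCE
    obtain ⟨hE, hU⟩ := h3.move_right H j k1 k2
    refine ⟨?_, ?_, ?_⟩
    · rw [Function.update_of_ne (Fin.succ_ne_zero j).symm, h1]
    -- At the last index there is no next product to receive `E`, but there `E` is empty.
    · by_cases hj : j = Fin.last m
      · subst hj
        rw [Fin.succ_last, Function.update_self, hE rfl, h2, Tableau.empty_mul]
      · rw [Function.update_of_ne, h2]
        rw [← Fin.succ_last]
        exact fun hcon => hj (Fin.succ_injective _ hcon).symm
    · convert hU using 2 with k
      by_cases hk : k = j
      · subst hk
        rw [Function.update_self, Function.update_of_ne Fin.castSucc_lt_succ.ne, if_pos rfl]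
      · rw [Function.update_of_ne (fun hcon => hk (Fin.succ_injective _ hcon)), if_neg hk]
        split
        · rename_i hk'
          rw [hk', Function.update_self, mul_assoc]
        · rename_i hk'
          rw [Function.update_of_ne hk']

/-- The analogue of `move_right` for rows: the lower rectangle is no taller, and the previous
product receives `C` on the right. -/
theorem move_left (H : SimpleFactorizationsFactor D.bottom) (h : IsFactorPair D Q P)
    (i : Fin (m + 1 + 1)) {C E : Tableau} (hCE : (P i).below (r.numRows i (i + 1)) = C * E) :
    IsFactorPair D (Function.update Q i (Q i * C))
      (Function.update P i (E * (P i).top (r.numRows i (i + 1)))) := by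
  obtain ⟨h1, h2, h3⟩ := h
  induction i using Fin.lastCases with
  | last =>
    rw [h2, Tableau.below_empty] at hCE
    obtain ⟨rfl, rfl⟩ := Tableau.mul_eq_empty hCE.symm
    rw [h2, Tableau.top_empty, Tableau.mul_empty, Tableau.empty_mul, ← h2,
      Function.update_eq_self, Function.update_eq_self]
    exact ⟨h1, h2, h3⟩
  | cast j =>
    rw [Fin.val_castSucc] at hCE ⊢
    obtain ⟨k1, k2⟩ := Tableau.cut_right_factor_mul (r.numRows_bottom_le j.isLt)
      (B := Q j.succ) hCE
    obtain ⟨hC, hU⟩ := h3.move_left H j k1 k2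
    refine ⟨?_, ?_, ?_⟩
    · by_cases hj : j = 0
      · subst hj
        rw [Fin.castSucc_zero, Function.update_self, hC rfl, h1, Tableau.empty_mul]
      · rw [Function.update_of_ne, h1]
        rw [← Fin.castSucc_zero]
        exact fun hcon => hj (Fin.castSucc_injective _ hcon).symm
    · rw [Function.update_of_ne (Fin.castSucc_lt_last j).ne', h2]
    · convert hU using 2 with k
      by_cases hk : k = j
      · subst hk
        rw [Function.update_self, Function.update_of_ne Fin.castSucc_lt_succ.ne', if_pos rfl]
      · rw [Function.update_of_ne (fun hcon => hk (Fin.castSucc_injective _ hcon)), if_neg hk]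
        split
        · rename_i hk'
          rw [hk', Function.update_self, mul_assoc]
        · rename_i hk'
          rw [Function.update_of_ne hk']

theorem update_simple (H : SimpleFactorizationsFactor D.bottom) (h : IsFactorPair D Q P)
    (i : Fin (m + 1 + 1)) {W q p : Tableau} (hW : W = Q i * D.T i (i + 1) * P i)
    (hs : Tableau.IsSimpleFactorization (r.numRows i (i + 1)) (r.numCols i (i + 1)) W q
      (D.T i (i + 1)) p) :
    IsFactorPair D (Function.update Q i q) (Function.update P i p) := by
  obtain ⟨_, _, Q', P', hZ, rfl, rfl⟩ := hs
  obtain ⟨e1, _, e3⟩ := h.rect_cut i hW rfl rfl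
  -- First all columns of `Q i` beyond the rectangle go to `P i`, then all rows of the new `P i`
  -- below it go back. By `e1` and `e3` the factors are then determined by `W` alone.
  have h1 := h.move_right H i (C := ∅) (by rw [Tableau.empty_mul])
  have h2 := h1.move_left H i (E := ∅) (by rw [Tableau.mul_empty])
  simp only [Function.update_self, Function.update_idem, Tableau.mul_empty, Tableau.empty_mul,
    ← e1, ← e3] at h2
  -- The left factor is now the part of `W` below the rectangle's rows; its columns beyond the
  -- rectangle form Z, so the given splitting of Z can be carried out.
  have h3 := h2.move_right H i (C := Q') (E := P') (by rw [Function.update_self, hZ])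
  simpa only [Function.update_self, Function.update_idem] using h3

end IsFactorPair

theorem simpleFactorizationsFactor {m : ℕ} {r : RankConditions (m + 1)} (D : TableauDiagram r) :
    SimpleFactorizationsFactor D := by
  induction m with
  | zero =>
    intro W Q P hs hW
    have h0 : W 0 = D.T 0 1 := hW
    have h1 : W 0 = Q 0 * D.T 0 1 * P 0 := (hs 0).2.1
    -- With a single row, counting letters in T = Q · T · P forces both outer factors to be empty.
    have h2 := Tableau.word_length_mul (Q 0 * D.T 0 1) (P 0)
    rw [← h1, h0, Tableau.word_length_mul] at h2
    exact ⟨Tableau.eq_empty_of_word (by omega), Tableau.eq_empty_of_word (by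
      rw [show Fin.last 0 = 0 from rfl]; omega), trivial⟩
  | succ m ih =>
    intro W Q P hs hW
    obtain ⟨Q', P', hW', hQP⟩ := (isFactorSequence_iff D W).1 hW
    -- The set `s` consists of the indices at which the factorization has already been replaced; at
    -- any other index the original one is still present and still multiplies to `W i`.
    have key : ∀ s : Finset (Fin (m + 1 + 1)),
        IsFactorPair D (s.piecewise Q Q') (s.piecewise P P') := by
      intro s
      induction s using Finset.induction_on with
      | empty => simpa using hQP
      | insert i s hi ihs =>
        rw [Finset.piecewise_insert, Finset.piecewise_insert]
        refine ihs.update_simple (ih D.bottom) i (W := W i) ?_ (hs i)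
        rw [Finset.piecewise_eq_of_notMem _ _ _ hi, Finset.piecewise_eq_of_notMem _ _ _ hi, hW']
    simpa using key Finset.univ

/-- The diagram has `m + 1 ≥ 1` rows; for `i : Fin (m + 1)`, the tableaux `W i`, `Q i`, `P i` are
`W_{i+1}`, `Q_i`, `P_{i+1}` of the factorization `W_{i+1} = Q_i · T_{i,i+1} · P_{i+1}`. -/
theorem mainTheorem3 (m : ℕ) (r : RankConditions (m + 1)) (D : TableauDiagram r)
    (W Q P : Fin (m + 1) → Tableau)
    (hW : ∀ i : Fin (m + 1), (W i).ContainsUpperLeft (D.T i (i + 1)))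
    (hQP : ∀ i : Fin (m + 1), Tableau.IsSimpleFactorization
      (r.numRows i (i + 1)) (r.numCols i (i + 1)) (W i) (Q i) (D.T i (i + 1)) (P i)) :
    IsFactorSequence D W ↔
      Q 0 = ∅ ∧ P (Fin.last m) = ∅ ∧
        IsFactorSequence D.bottom (fun i : Fin m => P i.castSucc * Q i.succ) := by
  rw [isFactorSequence_iff]
  constructor
  · rintro ⟨Q', P', h⟩
    exact simpleFactorizationsFactor D W Q P hQP ((isFactorSequence_iff D W).2 ⟨Q', P', h⟩)
  · exact fun h => ⟨Q, P, fun i => (hQP i).2.1, h⟩
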